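/- Let $N,p,q\ge 0$ be integers. Let $\Gamma_N=\mathbb{C}[\theta_1,\dots,\theta_N]=\Gamma_N^0\oplus\Gamma_N^1$ be the complex Grassmann algebra on $N$ odd generators with its even and odd parts, $(\Gamma_N^0)^*$ the group of invertible elements of $\Gamma_N^0$, and $B=\Gamma_N^0\setminus(\Gamma_N^0)^*$. A super-ringed space over $\mathbb{C}$ is a topological space with a sheaf of super-commutative $\mathbb{C}$-algebras. A number $c$ is the value of a section $s$ at $x$ if $s-c$ is not invertible on any neighbourhood of $x$. A morphism $\tau: X\to Y$ is a continuous map $\tau^\sim: X\to Y$ of the underlying spaces together with parity-preserving $\mathbb{C}$-algebra homomorphisms $\tau^*:\mathcal{O}_Y(V)\to\mathcal{O}_X((\tau^\sim)^{-1}V)$, $V\subseteq Y$ open, which commute with restrictions and satisfy: if $s$ has value $c$ at $\tau^\sim(x)$, then $\tau^*s$ has value $c$ at $x$. Let $\mathbb{C}^{0|N}$ be the one-point space $\{P\}$ with algebra of functions $\Gamma_N$. Let $\mathbb{P}^{p|q}$ be the superprojective space: its underlying space is the complex projective space $\mathbb{P}^p$, and for $V\subseteq\mathbb{P}^p$ open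 with preimage $V'\subseteq\mathbb{C}^{p+1}\setminus\{0\}$ its algebra of sections over $V$ is the algebra of $\mathbb{C}^*$-invariants of $H(V')[\theta_1,\dots,\theta_q]$. Here $H(V')$ is the algebra of holomorphic functions on $V'$, the $\theta_r$ are odd generators, and $t\in\mathbb{C}^*$ acts by $\sum_I f_I(z)\theta^I\mapsto\sum_I t^{-|I|}f_I(t^{-1}z)\theta^I$. On the open set $X_i=\{z_i\ne 0\}$, $0\le i\le p$, one has the even sections $\Xi^{(i)}_l=z_l/z_i$ ($0\le l\le p$) and the odd sections $\Theta^{(i)}_r=\theta_r/z_i$ ($1\le r\le q$). Then there is a bijection $$\frac{\left((\Gamma_N^0)^{p+1}\setminus B^{p+1}\right)\times(\Gamma_N^1)^q}{(\Gamma_N^0)^*}\;\xrightarrow{\ \sim\ }\;\operatorname{Hom}(\mathbb{C}^{0|N},\mathbb{P}^{p|q}),$$ where $(\Gamma_N^0)^*$ acts by simultaneous multiplication of all coordinates, such that the morphism $\tau$ corresponding to the class of $(z_0,\dots,z_p,\eta_1,\dots,\eta_q)$ has the following properties. Its image point is $\tau^\sim(P)=[z_0^\sim:\dots:z_p^\sim]$,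 where $z_l^\sim\in\mathbb{C}$ is the degree-zero component of $z_l$ (in particular these components are not all zero). For every $i$ such that $z_i$ is invertible, $\tau^\sim(P)\in X_i$ and $$\tau^*(\Xi^{(i)}_l)=z_i^{-1}z_l\quad(0\le l\le p),\qquad \tau^*(\Theta^{(i)}_r)=z_i^{-1}\eta_r\quad(1\le r\le q).$$ -/

import Mathlib

namespace SuperGeometry

/-! ### Grassmann algebras -/

/-- The complex Grassmann algebra `Γ_n = ℂ[θ_1, …, θ_n]` on `n` odd generators. -/
abbrev Grassmann (n : ℕ) : Type := ExteriorAlgebra ℂ (Fin n → ℂ)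

/-- The `r`-th generator `θ_r` of the Grassmann algebra. -/
noncomputable def Grassmann.gen {n : ℕ} (r : Fin n) : Grassmann n :=
  ExteriorAlgebra.ι ℂ (Pi.single r 1)

/-- The `ℤ/2`-grading of the Grassmann algebra: `gParity n 0` is spanned by products of an even
number of generators, `gParity n 1` by products of an odd number of generators. -/
def gParity (n : ℕ) (i : ZMod 2) : Submodule ℂ (Grassmann n) :=
  CliffordAlgebra.evenOdd (0 : QuadraticForm ℂ (Fin n → ℂ)) i

/-- The rescaling `θ_r ↦ c θ_r` of the Grassmann algebra; it multiplies `θ^I` by `c ^ |I|`. -/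
noncomputable def Grassmann.rescale (n : ℕ) (c : ℂ) : Grassmann n →ₐ[ℂ] Grassmann n :=
  ExteriorAlgebra.map (c • LinearMap.id)

theorem gParity_one_mem (n : ℕ) : (1 : Grassmann n) ∈ gParity n 0 :=
  SetLike.GradedOne.one_mem (A := CliffordAlgebra.evenOdd (0 : QuadraticForm ℂ (Fin n → ℂ)))

theorem gParity_mul_mem {n : ℕ} {i j : ZMod 2} {a b : Grassmann n} (ha : a ∈ gParity n i)
    (hb : b ∈ gParity n j) : a * b ∈ gParity n (i + j) :=
  SetLike.GradedMul.mul_mem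
    (A := CliffordAlgebra.evenOdd (0 : QuadraticForm ℂ (Fin n → ℂ))) ha hb

theorem gParity_isCompl (n : ℕ) : IsCompl (gParity n 0) (gParity n 1) :=
  CliffordAlgebra.evenOdd_isCompl _

theorem ι_mul_comm_involute {n : ℕ} (m : Fin n → ℂ) (x : Grassmann n) :
    ExteriorAlgebra.ι ℂ m * x =
      CliffordAlgebra.involute (Q := (0 : QuadraticForm ℂ (Fin n → ℂ))) x *
        ExteriorAlgebra.ι ℂ m := by
  induction x using ExteriorAlgebra.induction with
  | algebraMap r => simpa using (Algebra.commutes r _).symm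
  | ι y =>
    have h := ExteriorAlgebra.ι_add_mul_swap (R := ℂ) m y
    have h2 := CliffordAlgebra.involute_ι (Q := (0 : QuadraticForm ℂ (Fin n → ℂ))) y
    rw [show CliffordAlgebra.involute (ExteriorAlgebra.ι ℂ y) = - ExteriorAlgebra.ι ℂ y from h2,
      neg_mul]
    exact eq_neg_of_add_eq_zero_left h
  | mul a b ha hb => rw [← mul_assoc, ha, mul_assoc, hb, map_mul, mul_assoc]
  | add a b ha hb => rw [mul_add, ha, hb, map_add, add_mul]

theorem involute_eq_of_mem {n : ℕ} {i : ZMod 2} {x : Grassmann n} (hx : x ∈ gParity n i) :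
    CliffordAlgebra.involute (Q := (0 : QuadraticForm ℂ (Fin n → ℂ))) x =
      (-1 : ℂ) ^ i.val • x := by
  obtain rfl | rfl : i = 0 ∨ i = 1 := (by decide : ∀ k : ZMod 2, k = 0 ∨ k = 1) i
  · simpa using CliffordAlgebra.involute_eq_of_mem_even hx
  · simpa [ZMod.val_one] using CliffordAlgebra.involute_eq_of_mem_odd hx

theorem gParity_superComm {n : ℕ} {i j : ZMod 2} {a b : Grassmann n} (ha : a ∈ gParity n i)
    (hb : b ∈ gParity n j) : a * b = (-1 : ℂ) ^ (i.val * j.val) • (b * a) := by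
  have hι : ∀ m : Fin n → ℂ, ExteriorAlgebra.ι ℂ m * b =
      (-1 : ℂ) ^ j.val • (b * ExteriorAlgebra.ι ℂ m) := fun m => by
    rw [ι_mul_comm_involute, involute_eq_of_mem hb, smul_mul_assoc]
  have hsq : (-1 : ℂ) ^ j.val * (-1 : ℂ) ^ j.val = 1 := by
    rw [← mul_pow]; simp
  have key : ∀ m₁ m₂ : Fin n → ℂ, ∀ x : Grassmann n, ∀ c : ℂ, x * b = c • (b * x) →
      ExteriorAlgebra.ι ℂ m₁ * ExteriorAlgebra.ι ℂ m₂ * x * b =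
        c • (b * (ExteriorAlgebra.ι ℂ m₁ * ExteriorAlgebra.ι ℂ m₂ * x)) := by
    intro m₁ m₂ x c hx
    rw [mul_assoc _ x b, hx, mul_smul_comm, ← mul_assoc, mul_assoc _ _ b, hι m₂, mul_smul_comm,
      ← mul_assoc, hι m₁, smul_mul_assoc, smul_mul_assoc, smul_mul_assoc,
      smul_smul ((-1 : ℂ) ^ j.val), hsq, one_smul]
    simp only [mul_assoc]
  obtain rfl | rfl : i = 0 ∨ i = 1 := (by decide : ∀ k : ZMod 2, k = 0 ∨ k = 1) i
  · simp only [ZMod.val_zero, zero_mul, pow_zero]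
    refine CliffordAlgebra.even_induction (0 : QuadraticForm ℂ (Fin n → ℂ))
      (motive := fun x _ => x * b = (1 : ℂ) • (b * x)) ?_ ?_ ?_ a ha
    · intro r; simpa using Algebra.commutes r b
    · intro x y _ _ hx hy; rw [add_mul, hx, hy, mul_add, smul_add]
    · intro m₁ m₂ x _ hx; exact key m₁ m₂ x _ hx
  · have h1 : (-1 : ℂ) ^ (ZMod.val (1 : ZMod 2) * j.val) = (-1 : ℂ) ^ j.val := by
      simp [ZMod.val_one]
    refine Eq.trans ?_ (congrArg (fun c : ℂ => c • (b * a)) h1.symm)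
    refine CliffordAlgebra.odd_induction (0 : QuadraticForm ℂ (Fin n → ℂ))
      (P := fun x _ => x * b = (-1 : ℂ) ^ j.val • (b * x)) ?_ ?_ ?_ a ha
    · intro m; exact hι m
    · intro x y _ _ hx hy; rw [add_mul, hx, hy, mul_add, smul_add]
    · intro m₁ m₂ x _ hx; exact key m₁ m₂ x _ hx

/-- The projection of the Grassmann algebra onto its even part. -/
noncomputable def evenProj (n : ℕ) : Grassmann n →ₗ[ℂ] Grassmann n :=
  (1 / 2 : ℂ) • (LinearMap.id +
    (CliffordAlgebra.involute (Q := (0 : QuadraticForm ℂ (Fin n → ℂ)))).toLinearMap)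

theorem evenProj_add {n : ℕ} {a b : Grassmann n} (ha : a ∈ gParity n 0) (hb : b ∈ gParity n 1) :
    evenProj n (a + b) = a := by
  have h0 := involute_eq_of_mem ha
  have h1 := involute_eq_of_mem hb
  simp only [ZMod.val_zero, pow_zero, one_smul, ZMod.val_one, pow_one, neg_smul] at h0 h1
  simp only [evenProj, LinearMap.smul_apply, LinearMap.add_apply, LinearMap.id_apply,
    AlgHom.toLinearMap_apply, map_add, h0, h1]
  module

theorem evenProj_mem {n : ℕ} (a : Grassmann n) :
    evenProj n a ∈ gParity n 0 ∧ a - evenProj n a ∈ gParity n 1 := by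
  obtain ⟨x, hx, y, hy, rfl⟩ := Submodule.mem_sup.1
    (show a ∈ gParity n 0 ⊔ gParity n 1 by
      rw [(gParity_isCompl n).sup_eq_top]; exact Submodule.mem_top)
  rw [evenProj_add hx hy]
  exact ⟨hx, by rwa [add_sub_cancel_left]⟩

theorem evenProj_rescale {n : ℕ} (c : ℂ) (a : Grassmann n) :
    evenProj n (Grassmann.rescale n c a) = Grassmann.rescale n c (evenProj n a) := by
  have h : (CliffordAlgebra.involute (Q := (0 : QuadraticForm ℂ (Fin n → ℂ)))).comp
      (Grassmann.rescale n c) = (Grassmann.rescale n c).comp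
        (CliffordAlgebra.involute (Q := (0 : QuadraticForm ℂ (Fin n → ℂ)))) := by
    refine CliffordAlgebra.hom_ext (LinearMap.ext fun m => ?_)
    have e : Grassmann.rescale n c (CliffordAlgebra.ι 0 m) =
        c • CliffordAlgebra.ι (0 : QuadraticForm ℂ (Fin n → ℂ)) m := by
      have := ExteriorAlgebra.map_apply_ι (R := ℂ) (c • LinearMap.id : (Fin n → ℂ) →ₗ[ℂ] _) m
      simpa only [Grassmann.rescale, LinearMap.smul_apply, LinearMap.id_apply, map_smul] using this
    simp only [AlgHom.toLinearMap_apply, LinearMap.comp_apply, AlgHom.comp_apply,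
      CliffordAlgebra.involute_ι, map_neg, e, map_smul]
    rw [smul_neg]
  have h' := AlgHom.congr_fun h a
  simp only [AlgHom.comp_apply] at h'
  simp only [evenProj, LinearMap.smul_apply, LinearMap.add_apply, LinearMap.id_apply,
    AlgHom.toLinearMap_apply, map_add, map_smul, h']

/-! ### Super-ringed spaces over `ℂ` and their morphisms -/

/-- A super-ringed space over `ℂ`: a topological space with a sheaf of super-commutative
(`ℤ/2`-graded) `ℂ`-algebras. -/
structure SuperRingedSpace where
  /-- the underlying topological space -/
  carrier : Type
  [top : TopologicalSpace carrier]
  /-- the algebra of sections over an open set -/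
  sec : TopologicalSpace.Opens carrier → Type
  [ring : ∀ U, Ring (sec U)]
  [algebra : ∀ U, Algebra ℂ (sec U)]
  /-- the even (`0`) and odd (`1`) sections -/
  parity : ∀ U, ZMod 2 → Submodule ℂ (sec U)
  /-- restriction of sections -/
  res : ∀ {U V : TopologicalSpace.Opens carrier}, U ≤ V → sec V →ₐ[ℂ] sec U
  parity_isCompl : ∀ U, IsCompl (parity U 0) (parity U 1)
  one_mem_parity : ∀ U, (1 : sec U) ∈ parity U 0
  mul_mem_parity : ∀ U (i j : ZMod 2) (a b : sec U),
    a ∈ parity U i → b ∈ parity U j → a * b ∈ parity U (i + j)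
  superComm : ∀ U (i j : ZMod 2) (a b : sec U),
    a ∈ parity U i → b ∈ parity U j → a * b = (-1 : ℂ) ^ (i.val * j.val) • (b * a)
  res_mem_parity : ∀ {U V : TopologicalSpace.Opens carrier} (h : U ≤ V) (i : ZMod 2) (a : sec V),
    a ∈ parity V i → res h a ∈ parity U i
  res_self : ∀ (U : TopologicalSpace.Opens carrier) (a : sec U), res (le_refl U) a = a
  res_res : ∀ {U V W : TopologicalSpace.Opens carrier} (h₁ : U ≤ V) (h₂ : V ≤ W) (a : sec W),
    res h₁ (res h₂ a) = res (h₁.trans h₂) a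
  existsUnique_glue : ∀ {ι : Type} (U : ι → TopologicalSpace.Opens carrier) (s : ∀ k, sec (U k)),
    (∀ k l, res (inf_le_left : U k ⊓ U l ≤ U k) (s k) =
      res (inf_le_right : U k ⊓ U l ≤ U l) (s l)) →
    ∃! t : sec (⨆ k, U k), ∀ k, res (le_iSup U k) t = s k

attribute [instance] SuperRingedSpace.top SuperRingedSpace.ring SuperRingedSpace.algebra

/-- The number `c` is the value at `x` of the section `s` over `U ∋ x`: the section `s - c` is not
invertible on any neighbourhood of `x`. -/
def SuperRingedSpace.HasValue (X : SuperRingedSpace) {U : TopologicalSpace.Opens X.carrier}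
    (s : X.sec U) (x : X.carrier) (c : ℂ) : Prop :=
  x ∈ U ∧ ∀ (V : TopologicalSpace.Opens X.carrier) (h : V ≤ U), x ∈ V →
    ¬ IsUnit (X.res h (s - algebraMap ℂ (X.sec U) c))

/-- A morphism of super-ringed spaces: a continuous map together with pull-back homomorphisms of
superalgebras, commuting with restrictions and compatible with the values of sections. -/
@[ext]
structure SuperRingedSpace.Hom (X Y : SuperRingedSpace) where
  /-- the map of underlying spaces -/
  base : C(X.carrier, Y.carrier)
  /-- the pull-back of sections -/
  pullback : ∀ V : TopologicalSpace.Opens Y.carrier,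
    Y.sec V →ₐ[ℂ] X.sec (TopologicalSpace.Opens.comap base V)
  pullback_mem_parity : ∀ V (i : ZMod 2) (s : Y.sec V), s ∈ Y.parity V i →
    pullback V s ∈ X.parity (TopologicalSpace.Opens.comap base V) i
  pullback_res : ∀ {V W : TopologicalSpace.Opens Y.carrier} (h : V ≤ W) (s : Y.sec W),
    pullback V (Y.res h s) =
      X.res (TopologicalSpace.Opens.comap_mono base h) (pullback W s)
  pullback_hasValue : ∀ (V : TopologicalSpace.Opens Y.carrier) (s : Y.sec V) (x : X.carrier)
    (c : ℂ), Y.HasValue s (base x) c → X.HasValue (pullback V s) x c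

/-! ### Super-ringed spaces of Grassmann-valued functions -/

/-- Restriction of Grassmann-valued functions to a smaller set. -/
def restrictFun {m q : ℕ} {A B : Set (Fin m → ℂ)} (h : A ⊆ B) :
    (B → Grassmann q) →ₐ[ℂ] (A → Grassmann q) where
  toFun F := fun a => F ⟨a.1, h a.2⟩
  map_one' := rfl
  map_mul' _ _ := rfl
  map_zero' := rfl
  map_add' _ _ := rfl
  commutes' _ := rfl

/-- The super-ringed space whose sections over `U` are those functions on a set `cone U ⊆ ℂ^m` with
values in the Grassmann algebra `Γ_q` that belong to a prescribed subalgebra `S U`. The hypotheses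
say that the `S U` form a sheaf and are stable under taking even parts. -/
noncomputable def SuperRingedSpace.ofFunctions (X : Type) [TopologicalSpace X] (m q : ℕ)
    (cone : TopologicalSpace.Opens X → Set (Fin m → ℂ))
    (S : ∀ U, Subalgebra ℂ (cone U → Grassmann q))
    (cone_mono : ∀ U V, U ≤ V → cone U ⊆ cone V)
    (cone_inf : ∀ U V, cone U ∩ cone V ⊆ cone (U ⊓ V))
    (cone_iSup : ∀ {ι : Type} (U : ι → TopologicalSpace.Opens X), cone (⨆ k, U k) ⊆ ⋃ k, cone (U k))
    (S_res : ∀ U V (h : U ≤ V) (F : cone V → Grassmann q), F ∈ S V →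
      restrictFun (cone_mono U V h) F ∈ S U)
    (S_glue : ∀ {ι : Type} (U : ι → TopologicalSpace.Opens X) (F : cone (⨆ k, U k) → Grassmann q),
      (∀ k, restrictFun (cone_mono _ _ (le_iSup U k)) F ∈ S (U k)) → F ∈ S (⨆ k, U k))
    (S_even : ∀ U (F : cone U → Grassmann q), F ∈ S U → (fun z => evenProj q (F z)) ∈ S U) :
    SuperRingedSpace where
  carrier := X
  sec U := S U
  parity U i :=
    { carrier := {s | ∀ z, s.1 z ∈ gParity q i}
      add_mem' := fun ha hb z => Submodule.add_mem _ (ha z) (hb z)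
      zero_mem' := fun _ => Submodule.zero_mem _
      smul_mem' := fun c _ ha z => Submodule.smul_mem _ c (ha z) }
  res {U V} h :=
    ((restrictFun (cone_mono U V h)).comp (S V).val).codRestrict (S U)
      (fun s => S_res U V h s.1 s.2)
  parity_isCompl U := by
    constructor
    · rw [Submodule.disjoint_def]
      intro s h0 h1
      refine Subtype.ext (funext fun z => ?_)
      exact Submodule.disjoint_def.1 (gParity_isCompl q).disjoint _ (h0 z) (h1 z)
    · rw [codisjoint_iff, Submodule.eq_top_iff']
      intro s
      refine Submodule.mem_sup.2 ⟨⟨_, S_even U s.1 s.2⟩, fun z => (evenProj_mem (s.1 z)).1,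
        s - ⟨_, S_even U s.1 s.2⟩, fun z => (evenProj_mem (s.1 z)).2, by abel⟩
  one_mem_parity U := fun _ => gParity_one_mem q
  mul_mem_parity U i j a b ha hb := fun z => gParity_mul_mem (ha z) (hb z)
  superComm U i j a b ha hb :=
    Subtype.ext (funext fun z => gParity_superComm (ha z) (hb z))
  res_mem_parity h i a ha := fun z => ha ⟨z.1, cone_mono _ _ h z.2⟩
  res_self U a := rfl
  res_res h₁ h₂ a := rfl
  existsUnique_glue {ι} U s hs := by
    have hs' : ∀ (k l : ι) (z : Fin m → ℂ) (hk : z ∈ cone (U k)) (hl : z ∈ cone (U l)),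
        (s k).1 ⟨z, hk⟩ = (s l).1 ⟨z, hl⟩ := fun k l z hk hl =>
      congrFun (congrArg Subtype.val (hs k l)) ⟨z, cone_inf _ _ ⟨hk, hl⟩⟩
    choose f hf using fun z : cone (⨆ k, U k) => Set.mem_iUnion.1 (cone_iSup U z.2)
    let F : cone (⨆ k, U k) → Grassmann q := fun z => (s (f z)).1 ⟨z.1, hf z⟩
    have hF : ∀ k, restrictFun (cone_mono _ _ (le_iSup U k)) F = (s k).1 := fun k =>
      funext fun z => hs' _ _ _ _ _
    refine ⟨⟨F, S_glue U F fun k => by rw [hF k]; exact (s k).2⟩,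
      fun k => Subtype.ext (hF k), fun t ht => Subtype.ext (funext fun z => ?_)⟩
    exact congrFun (congrArg Subtype.val (ht (f z))) ⟨z.1, hf z⟩

theorem extend_val_apply {m : ℕ} {W : Set (Fin m → ℂ)} (g : W → ℂ) {z : Fin m → ℂ} (hz : z ∈ W) :
    Function.extend Subtype.val g 0 z = g ⟨z, hz⟩ :=
  Subtype.val_injective.extend_apply g 0 ⟨z, hz⟩

/-- The algebra `H(W)[θ_1, …, θ_q]` for `W ⊆ ℂ^m` open, realised as the algebra of functions
`∑ f_I θ^I` on `W` with values in `Γ_q` all of whose coefficients (equivalently, whose compositions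
with all linear functionals of the finite-dimensional space `Γ_q`) are holomorphic. The extension
by zero outside `W` has no influence on differentiability on the open set `W`. -/
noncomputable def holo {m : ℕ} (q : ℕ) (W : Set (Fin m → ℂ)) : Subalgebra ℂ (W → Grassmann q) where
  carrier := {F | ∀ φ : Grassmann q →ₗ[ℂ] ℂ,
    DifferentiableOn ℂ (Function.extend Subtype.val (fun z => φ (F z)) 0) W}
  mul_mem' := by
    intro F G hF hG φ
    let b := (Pi.basisFun ℂ (Fin q)).ExteriorAlgebra
    have h : DifferentiableOn ℂ (fun z => ∑ I, ∑ J,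
        Function.extend Subtype.val (fun z : W => b.coord I (F z)) 0 z *
          Function.extend Subtype.val (fun z : W => b.coord J (G z)) 0 z * φ (b I * b J)) W :=
      DifferentiableOn.fun_sum fun I _ => DifferentiableOn.fun_sum fun J _ =>
        ((hF (b.coord I)).mul (hG (b.coord J))).mul_const _
    refine h.congr fun z hz => ?_
    simp only [extend_val_apply _ hz, Pi.mul_apply, Module.Basis.coord_apply]
    conv_lhs => rw [← b.sum_repr (F ⟨z, hz⟩), ← b.sum_repr (G ⟨z, hz⟩), Finset.sum_mul_sum]
    simp only [map_sum, smul_mul_smul_comm, map_smul, smul_eq_mul]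
  add_mem' := by
    intro F G hF hG φ
    refine ((hF φ).add (hG φ)).congr fun z hz => ?_
    simp [extend_val_apply _ hz]
  algebraMap_mem' := by
    intro c φ
    refine (differentiableOn_const (φ (algebraMap ℂ _ c))).congr fun z hz => ?_
    simp [extend_val_apply _ hz]

theorem holo_res {m q : ℕ} {A B : Set (Fin m → ℂ)} (h : A ⊆ B) {F : B → Grassmann q}
    (hF : F ∈ holo q B) : restrictFun h F ∈ holo q A := by
  intro φ
  refine ((hF φ).mono h).congr fun z hz => ?_
  rw [extend_val_apply _ hz, extend_val_apply _ (h hz)]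
  rfl

theorem holo_glue {m q : ℕ} {ι : Type} {W : Set (Fin m → ℂ)} (A : ι → Set (Fin m → ℂ))
    (hA : ∀ k, IsOpen (A k)) (hAW : ∀ k, A k ⊆ W) (hW : W ⊆ ⋃ k, A k) {F : W → Grassmann q}
    (hF : ∀ k, restrictFun (hAW k) F ∈ holo q (A k)) : F ∈ holo q W := by
  intro φ z hz
  obtain ⟨k, hk⟩ := Set.mem_iUnion.1 (hW hz)
  have h : DifferentiableOn ℂ (Function.extend Subtype.val (fun z : W => φ (F z)) 0) (A k) := by
    refine (hF k φ).congr fun y hy => ?_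
    rw [extend_val_apply _ hy, extend_val_apply _ (hAW k hy)]
    rfl
  exact (h.differentiableAt ((hA k).mem_nhds hk)).differentiableWithinAt

theorem holo_even {m q : ℕ} {W : Set (Fin m → ℂ)} {F : W → Grassmann q} (hF : F ∈ holo q W) :
    (fun z => evenProj q (F z)) ∈ holo q W :=
  fun φ => hF (φ.comp (evenProj q))

/-! ### Affine superspaces -/

/-- The complex superspace `ℂ^{p|q}`: over an open `U ⊆ ℂ^p` its sections are
`H(U)[θ_1, …, θ_q]`. -/
noncomputable def affineSuperspace (p q : ℕ) : SuperRingedSpace :=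
  SuperRingedSpace.ofFunctions (Fin p → ℂ) p q (fun U => (U : Set (Fin p → ℂ)))
    (fun U => holo q (U : Set (Fin p → ℂ)))
    (fun _ _ h => h) (fun _ _ => by simp) (fun U => by simp)
    (fun _ _ h _ hF => holo_res h hF)
    (fun U _ hF => holo_glue (fun k => (U k : Set (Fin p → ℂ))) (fun k => (U k).2)
      (fun k => le_iSup U k) (by simp) hF)
    (fun _ _ hF => holo_even hF)

/-- The superpoint `ℂ^{0|N}`: one point, with algebra of functions `Γ_N`. -/
noncomputable abbrev superpoint (N : ℕ) : SuperRingedSpace := affineSuperspace 0 N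

/-! ### Superprojective spaces -/

/-- The complex projective space of dimension `p`. -/
abbrev ProjSpace (p : ℕ) : Type := Projectivization ℂ (Fin (p + 1) → ℂ)

noncomputable instance projSpaceTopology (p : ℕ) : TopologicalSpace (ProjSpace p) :=
  TopologicalSpace.coinduced (Projectivization.mk' ℂ) inferInstance

/-- The preimage in `ℂ^{p+1} \ {0}` of an open subset of the projective space. -/
def cone {p : ℕ} (V : TopologicalSpace.Opens (ProjSpace p)) : Set (Fin (p + 1) → ℂ) :=
  {z | ∃ hz : z ≠ 0, Projectivization.mk ℂ z hz ∈ V}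

theorem cone_isOpen {p : ℕ} (V : TopologicalSpace.Opens (ProjSpace p)) : IsOpen (cone V) := by
  have h : IsOpen ((Projectivization.mk' ℂ : {v : Fin (p + 1) → ℂ // v ≠ 0} → ProjSpace p) ⁻¹' V) :=
    V.2
  have h0 : IsOpen {v : Fin (p + 1) → ℂ | v ≠ 0} := isOpen_ne
  convert h0.isOpenMap_subtype_val _ h
  ext z
  simp [cone]

theorem smul_mem_cone {p : ℕ} {V : TopologicalSpace.Opens (ProjSpace p)} {z : Fin (p + 1) → ℂ}
    (hz : z ∈ cone V) (t : ℂˣ) : t • z ∈ cone V := by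
  obtain ⟨h0, hV⟩ := hz
  have h1 : t • z ≠ 0 := (smul_ne_zero_iff_ne t).2 h0
  refine ⟨h1, ?_⟩
  rwa [(Projectivization.mk_eq_mk_iff ℂ (t • z) z h1 h0).2 ⟨t, rfl⟩]

/-- The action of `t ∈ ℂ^*` on `H(V')[θ_1, …, θ_q]`:
`∑ f_I(z) θ^I ↦ ∑ t^{-|I|} f_I(t⁻¹ z) θ^I`. -/
noncomputable def scalarAct {p q : ℕ} {V : TopologicalSpace.Opens (ProjSpace p)} (t : ℂˣ)
    (F : cone V → Grassmann q) : cone V → Grassmann q :=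
  fun z => Grassmann.rescale q (t : ℂ)⁻¹ (F ⟨t⁻¹ • z.1, smul_mem_cone z.2 t⁻¹⟩)

/-- The sections of the structure sheaf of `ℙ^{p|q}` over `V`: the elements of
`H(V')[θ_1, …, θ_q]` invariant under `ℂ^*`, where `V'` is the preimage of `V`. -/
noncomputable def projSections (p q : ℕ) (V : TopologicalSpace.Opens (ProjSpace p)) :
    Subalgebra ℂ (cone V → Grassmann q) where
  carrier := {F | F ∈ holo q (cone V) ∧ ∀ t : ℂˣ, scalarAct t F = F}
  mul_mem' := by
    rintro F G ⟨hF, hF'⟩ ⟨hG, hG'⟩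
    refine ⟨mul_mem hF hG, fun t => ?_⟩
    conv_rhs => rw [← hF' t, ← hG' t]
    funext z
    simp [scalarAct]
  add_mem' := by
    rintro F G ⟨hF, hF'⟩ ⟨hG, hG'⟩
    refine ⟨add_mem hF hG, fun t => ?_⟩
    conv_rhs => rw [← hF' t, ← hG' t]
    funext z
    simp [scalarAct]
  algebraMap_mem' := by
    intro c
    refine ⟨Subalgebra.algebraMap_mem _ c, fun t => ?_⟩
    funext z
    simp [scalarAct]

/-- The superprojective space `ℙ^{p|q}`. -/
noncomputable def superProj (p q : ℕ) : SuperRingedSpace :=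
  SuperRingedSpace.ofFunctions (ProjSpace p) (p + 1) q cone (projSections p q)
    (fun _ _ h _ hz => ⟨hz.1, h hz.2⟩)
    (fun _ _ _ hz => ⟨hz.1.1, hz.1.2, hz.2.2⟩)
    (fun U z hz => by
      obtain ⟨h0, hz⟩ := hz
      obtain ⟨k, hk⟩ := TopologicalSpace.Opens.mem_iSup.1 hz
      exact Set.mem_iUnion.2 ⟨k, h0, hk⟩)
    (fun _ _ h F hF => ⟨holo_res _ hF.1, fun t => funext fun z =>
      congrFun (hF.2 t) ⟨z.1, z.2.1, h z.2.2⟩⟩)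
    (fun U F hF => by
      have hU : cone (⨆ k, U k) ⊆ ⋃ k, cone (U k) := fun z hz => by
        obtain ⟨h0, hz⟩ := hz
        obtain ⟨k, hk⟩ := TopologicalSpace.Opens.mem_iSup.1 hz
        exact Set.mem_iUnion.2 ⟨k, h0, hk⟩
      refine ⟨holo_glue (fun k => cone (U k)) (fun k => cone_isOpen _) _ hU fun k => (hF k).1,
        fun t => funext fun z => ?_⟩
      obtain ⟨k, hk⟩ := Set.mem_iUnion.1 (hU z.2)
      exact congrFun ((hF k).2 t) ⟨z.1, hk⟩)
    (fun U F hF => ⟨holo_even hF.1, fun t => funext fun z =>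
      (evenProj_rescale _ _).symm.trans (congrArg (evenProj q) (congrFun (hF.2 t) z))⟩)

/-- The open subset `X_i` of the projective space where `z_i ≠ 0`. -/
def chart {p : ℕ} (i : Fin (p + 1)) : TopologicalSpace.Opens (ProjSpace p) where
  carrier := {x | ∃ (z : Fin (p + 1) → ℂ) (hz : z ≠ 0), x = Projectivization.mk ℂ z hz ∧ z i ≠ 0}
  is_open' := by
    have h : (Projectivization.mk' ℂ : {v : Fin (p + 1) → ℂ // v ≠ 0} → ProjSpace p) ⁻¹'
        {x | ∃ (z : Fin (p + 1) → ℂ) (hz : z ≠ 0), x = Projectivization.mk ℂ z hz ∧ z i ≠ 0} =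
        {v | v.1 i ≠ 0} := by
      ext v
      constructor
      · rintro ⟨z, hz, hvz, hi⟩
        obtain ⟨a, ha⟩ := (Projectivization.mk_eq_mk_iff ℂ v.1 z v.2 hz).1 hvz
        simp only [Set.mem_ofPred_eq, ← ha]
        simpa [Units.smul_def] using hi
      · intro hv
        exact ⟨v.1, v.2, rfl, hv⟩
    change IsOpen ((Projectivization.mk' ℂ : {v : Fin (p + 1) → ℂ // v ≠ 0} → ProjSpace p) ⁻¹' _)
    rw [h]
    exact isOpen_ne_fun ((continuous_apply i).comp continuous_subtype_val) continuous_const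

theorem apply_ne_zero_of_mem_cone_chart {p : ℕ} {i : Fin (p + 1)} {z : Fin (p + 1) → ℂ}
    (hz : z ∈ cone (chart i)) : z i ≠ 0 := by
  obtain ⟨h0, w, hw, hzw, hi⟩ := hz
  obtain ⟨a, ha⟩ := (Projectivization.mk_eq_mk_iff ℂ z w h0 hw).1 hzw
  rw [← ha]
  simpa [Units.smul_def] using hi

/-- The even affine coordinate `Ξ_l^{(i)} = z_l / z_i`, a section over `X_i`. -/
noncomputable def evenCoord {p : ℕ} (q : ℕ) (i l : Fin (p + 1)) :
    (superProj p q).sec (chart i) :=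
  ⟨fun z => algebraMap ℂ (Grassmann q) (z.1 l / z.1 i), by
    intro φ
    have hl : DifferentiableOn ℂ (fun z : Fin (p + 1) → ℂ => z l) (cone (chart i)) :=
      (differentiable_apply l).differentiableOn
    have hi : DifferentiableOn ℂ (fun z : Fin (p + 1) → ℂ => z i) (cone (chart i)) :=
      (differentiable_apply i).differentiableOn
    have h : DifferentiableOn ℂ (fun z : Fin (p + 1) → ℂ => z l * (z i)⁻¹ * φ 1) (cone (chart i)) :=
      (hl.mul (hi.inv fun z hz => apply_ne_zero_of_mem_cone_chart hz)).mul_const _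
    refine h.congr fun z hz => ?_
    rw [extend_val_apply _ hz]
    beta_reduce
    rw [Algebra.algebraMap_eq_smul_one, map_smul, smul_eq_mul, div_eq_mul_inv], by
    intro t
    funext z
    have ht : ((t⁻¹ : ℂˣ) : ℂ) ≠ 0 := Units.ne_zero _
    simp only [scalarAct, AlgHom.commutes, Pi.smul_apply, Units.smul_def, smul_eq_mul]
    rw [mul_div_mul_left _ _ ht]⟩

/-- The odd affine coordinate `Θ_r^{(i)} = θ_r / z_i`, a section over `X_i`. -/
noncomputable def oddCoord {p q : ℕ} (i : Fin (p + 1)) (r : Fin q) :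
    (superProj p q).sec (chart i) :=
  ⟨fun z => (z.1 i)⁻¹ • Grassmann.gen r, by
    intro φ
    have h : DifferentiableOn ℂ (fun z : Fin (p + 1) → ℂ => (z i)⁻¹ * φ (Grassmann.gen r))
        (cone (chart i)) :=
      ((differentiable_apply (𝕜 := ℂ) i).differentiableOn.inv
        (fun z hz => apply_ne_zero_of_mem_cone_chart hz)).mul_const _
    refine h.congr fun z hz => ?_
    rw [extend_val_apply _ hz, map_smul, smul_eq_mul], by
    intro t
    funext z
    have hg : Grassmann.rescale q (t : ℂ)⁻¹ (Grassmann.gen r) = (t : ℂ)⁻¹ • Grassmann.gen r := by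
      simp [Grassmann.rescale, Grassmann.gen]
    simp only [scalarAct, map_smul, hg, Pi.smul_apply, Units.smul_def, smul_eq_mul, smul_smul]
    congr 1
    have ht : (t : ℂ) ≠ 0 := Units.ne_zero _
    rw [Units.val_inv_eq_inv_val, mul_inv, inv_inv, mul_right_comm, mul_inv_cancel₀ ht, one_mul]⟩

/-! ### Homogeneous coordinates with Grassmann-algebra entries -/

/-- The even part `Γ_N^0` of the Grassmann algebra. -/
def evenPart (N : ℕ) : Subalgebra ℂ (Grassmann N) :=
  CliffordAlgebra.even (0 : QuadraticForm ℂ (Fin N → ℂ))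

/-- The odd part `Γ_N^1` of the Grassmann algebra. -/
def oddPart (N : ℕ) : Submodule ℂ (Grassmann N) := gParity N 1

theorem evenPart_mul_oddPart {N : ℕ} (a : evenPart N) (b : oddPart N) :
    (a : Grassmann N) * b ∈ oddPart N := by
  simpa [oddPart] using gParity_mul_mem (i := 0) (j := 1) a.2 b.2

/-- The set `B` of non-invertible elements of `Γ_N^0`. -/
def nonUnits (N : ℕ) : Set (evenPart N) := {a | ¬ IsUnit a}

/-- The set `((Γ_N^0)^{p+1} \ B^{p+1}) × (Γ_N^1)^q`. -/
def homogeneousSet (N p q : ℕ) : Set ((Fin (p + 1) → evenPart N) × (Fin q → oddPart N)) :=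
  (Set.univ \ Set.pi Set.univ fun _ => nonUnits N) ×ˢ Set.univ

theorem mem_homogeneousSet {N p q : ℕ} (x : (Fin (p + 1) → evenPart N) × (Fin q → oddPart N)) :
    x ∈ homogeneousSet N p q ↔ ∃ i, IsUnit (x.1 i) := by
  simp [homogeneousSet, nonUnits, Set.mem_pi]

/-- The group `(Γ_N^0)^*` acts on `((Γ_N^0)^{p+1} \ B^{p+1}) × (Γ_N^1)^q` by multiplication of all
coordinates. -/
noncomputable instance homogeneousAction (N p q : ℕ) : MulAction (evenPart N)ˣ (homogeneousSet N p q) where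
  smul u x := ⟨(fun l => u * x.1.1 l, fun r => ⟨(u : evenPart N) * x.1.2 r,
      evenPart_mul_oddPart _ _⟩), by
    obtain ⟨i, hi⟩ := (mem_homogeneousSet x.1).1 x.2
    exact (mem_homogeneousSet _).2 ⟨i, u.isUnit.mul hi⟩⟩
  one_smul x := Subtype.ext (Prod.ext (funext fun l => one_mul _)
    (funext fun r => Subtype.ext (one_mul _)))
  mul_smul u v x := Subtype.ext (Prod.ext (funext fun l => mul_assoc _ _ _)
    (funext fun r => Subtype.ext (mul_assoc _ _ _)))

/-- The quotient of `((Γ_N^0)^{p+1} \ B^{p+1}) × (Γ_N^1)^q` by `(Γ_N^0)^*`. -/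
abbrev HomogeneousModel (N p q : ℕ) : Type :=
  MulAction.orbitRel.Quotient (evenPart N)ˣ (homogeneousSet N p q)

/-- The class `[z : θ]` of homogeneous coordinates in the quotient. -/
noncomputable def homogeneousClass {N p q : ℕ} (x : homogeneousSet N p q) : HomogeneousModel N p q :=
  Quotient.mk (MulAction.orbitRel (evenPart N)ˣ (homogeneousSet N p q)) x

/-- The body (value at the point of `ℂ^{0|N}`) of an element of the Grassmann algebra: its
component of degree zero. -/
noncomputable def body {N : ℕ} (a : Grassmann N) : ℂ := ExteriorAlgebra.algebraMapInv a

/-- The image `τ~(P)` of the unique point `P` of `ℂ^{0|N}` under a morphism. -/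
noncomputable def imagePoint {N : ℕ} {Y : SuperRingedSpace} (τ : (superpoint N).Hom Y) :
    Y.carrier :=
  τ.base (0 : Fin 0 → ℂ)

/-- The pull-back `τ^*(s) ∈ Γ_N` of a section `s` defined around the image point. -/
noncomputable def pullbackAt {N : ℕ} {Y : SuperRingedSpace} (τ : (superpoint N).Hom Y)
    {V : TopologicalSpace.Opens Y.carrier} (h : imagePoint τ ∈ V) (s : Y.sec V) : Grassmann N :=
  (τ.pullback V s).1 ⟨(0 : Fin 0 → ℂ), h⟩

end SuperGeometry

/-! Near a point with `z_i ≠ 0`, a section on the superprojective space is a polynomial in the odd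
coordinates `Θ_r` whose coefficients are holomorphic functions of the `Ξ_l`. A morphism from the
superpoint should therefore be the substitution of elements of `Γ_N` for these coordinates. The crux
is that such a substitution into holomorphic functions exists and is unique.

An even element `w_l` differs from its body `a_l` by a nilpotent, so only finitely many Taylor terms
at `a` matter. Hadamard's lemma writes `f - f(a)` as `∑ (z_l - a_l) g_l`. Iterated, it makes every
`f` congruent to a polynomial modulo each power of the ideal generated by the `z_l - a_l`. A
homomorphism with `z_l ↦ w_l` kills some power of this ideal, hence is determined by the `w_l`
(`holoNear.algHom_ext`). Conversely, evaluation of polynomials at `w` kills those that vanish at `a`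
to high order, so it extends to holomorphic functions (`holoNear.exists_algHom`).

For existence, homogeneous coordinates are substituted directly into functions on the cone
(`superEval`, `substMorphism`), so that no gluing over charts is needed. The value of a section is
its body, and substitution preserves bodies, so this is a morphism. For uniqueness, compatibility
with values forces `τ^* Ξ_l` to have the coordinates of the image point as bodies, which supplies
the nilpotency. Together with the homogeneity of sections, this shows that `τ` is determined by its
image point and its affine coordinates in one chart (`hom_superProj_ext`). Invariance under units,
injectivity and surjectivity then reduce to comparing the affine coordinates `z_i⁻¹ z_l` and `z_i⁻¹
η_r`. -/

/-! ### Parameter integrals and Hadamard's lemma for holomorphic functions -/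

open Filter Topology in
-- Differentiation under the integral sign. For holomorphic integrands a bound on `F` is enough,
-- because it bounds the derivative on a smaller ball; no regularity of the derivative in `θ` has to
-- be assumed.
theorem differentiableAt_intervalIntegral_of_bounded {m : ℕ} {F : (Fin m → ℂ) → ℝ → ℂ}
    {x₀ : Fin m → ℂ} {R M a b : ℝ} (hR : 0 < R)
    (hd : ∀ θ, DifferentiableOn ℂ (fun x => F x θ) (Metric.ball x₀ R))
    (hc : ∀ x ∈ Metric.ball x₀ R, Continuous (F x))
    (hM : ∀ x ∈ Metric.ball x₀ R, ∀ θ, ‖F x θ‖ ≤ M) :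
    DifferentiableAt ℂ (fun x => ∫ θ in a..b, F x θ) x₀ := by
  have hx₀ : x₀ ∈ Metric.ball x₀ R := Metric.mem_ball_self hR
  have hsub : ∀ x ∈ Metric.ball x₀ (R / 2), Metric.ball x (R / 2) ⊆ Metric.ball x₀ R := by
    intro x hx
    refine Metric.ball_subset_ball' ?_
    have := Metric.mem_ball.1 hx
    linarith
  have hda : ∀ θ, ∀ x ∈ Metric.ball x₀ R, DifferentiableAt ℂ (fun x => F x θ) x := fun θ x hx =>
    (hd θ).differentiableAt (Metric.isOpen_ball.mem_nhds hx)
  -- Cauchy-type estimate: the ball of radius `R / 2` about `x` stays inside the large ball, and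
  -- there values of `F` differ from `F x θ` by at most `2 * M`.
  have hbound : ∀ θ, ∀ x ∈ Metric.ball x₀ (R / 2),
      ‖fderiv ℂ (fun x => F x θ) x‖ ≤ 2 * M / (R / 2) := by
    intro θ x hx
    refine Complex.norm_fderiv_le_div_of_mapsTo_ball ((hd θ).mono (hsub x hx)) ?_ (by linarith)
    intro y hy
    rw [Metric.mem_closedBall, dist_eq_norm]
    refine (norm_sub_le _ _).trans ?_
    have h1 := hM y (hsub x hx hy) θ
    have h2 := hM x (hsub x hx (Metric.mem_ball_self (by linarith))) θ
    linarith
  -- The partial derivatives are pointwise limits of difference quotients, which are continuous in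
  -- `θ`; this gives measurability of the derivative.
  have hmeas : MeasureTheory.AEStronglyMeasurable (fun θ => fderiv ℂ (fun x => F x θ) x₀)
      (MeasureTheory.volume.restrict (Set.uIoc a b)) := by
    have hsum : (fun θ => fderiv ℂ (fun x => F x θ) x₀) = fun θ => ∑ j : Fin m,
        fderiv ℂ (fun x => F x θ) x₀ (Pi.single j 1) •
          (ContinuousLinearMap.proj j : (Fin m → ℂ) →L[ℂ] ℂ) := by
      funext θ
      ext v
      conv_lhs => rw [← Finset.univ_sum_single v]
      rw [map_sum]
      simp only [_root_.sum_apply, _root_.smul_apply,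
        ContinuousLinearMap.proj_apply, smul_eq_mul]
      refine Finset.sum_congr rfl fun j _ => ?_
      rw [mul_comm, ← smul_eq_mul, ← map_smul, ← Pi.single_smul, smul_eq_mul, mul_one]
    rw [hsum]
    refine Finset.aestronglyMeasurable_fun_sum _ fun j _ => ?_
    refine MeasureTheory.AEStronglyMeasurable.smul_const ?_ _
    let t : ℕ → ℂ := fun n => ((R / 2 / (n + 1) : ℝ) : ℂ)
    have ht0 : ∀ n, t n ≠ 0 := fun n => by
      simp only [t, ne_eq, Complex.ofReal_eq_zero]
      positivity
    have ht : Tendsto t atTop (𝓝 0) := by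
      have h1 := tendsto_one_div_add_atTop_nhds_zero_nat (𝕜 := ℝ)
      have h2 := h1.const_mul (R / 2)
      rw [mul_zero] at h2
      have h3 := (Complex.continuous_ofReal.tendsto 0).comp h2
      rw [Complex.ofReal_zero] at h3
      refine h3.congr fun n => ?_
      simp only [Function.comp_apply, t, mul_one_div]
    have hmem : ∀ n, x₀ + t n • Pi.single j (1 : ℂ) ∈ Metric.ball x₀ R := by
      intro n
      rw [mem_ball_iff_norm, add_sub_cancel_left, norm_smul]
      have h1 : ‖(Pi.single j (1 : ℂ) : Fin m → ℂ)‖ = 1 := by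
        rw [Pi.norm_single, norm_one]
      rw [h1, mul_one, Complex.norm_real, Real.norm_of_nonneg (by positivity)]
      refine lt_of_le_of_lt (div_le_self (by positivity) ?_) (half_lt_self hR)
      have : (0 : ℝ) ≤ n := n.cast_nonneg
      linarith
    refine aestronglyMeasurable_of_tendsto_ae atTop
      (f := fun n θ => (t n)⁻¹ • (F (x₀ + t n • Pi.single j (1 : ℂ)) θ - F x₀ θ))
      (fun n => Continuous.aestronglyMeasurable
        (((hc _ (hmem n)).sub (hc _ hx₀)).const_smul (t n)⁻¹))
      (Filter.Eventually.of_forall fun θ => ?_)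
    have hl := (hda θ x₀ hx₀).hasFDerivAt.hasLineDerivAt (Pi.single j (1 : ℂ))
    have hl' := hl.tendsto_slope_zero
    refine hl'.comp (tendsto_nhdsWithin_iff.2 ⟨ht, Filter.Eventually.of_forall ht0⟩) |>.congr ?_
    intro n
    simp
  refine (intervalIntegral.hasFDerivAt_integral_of_dominated_of_fderiv_le (𝕜 := ℂ)
    (F' := fun x θ => fderiv ℂ (fun x => F x θ) x) (bound := fun _ => 2 * M / (R / 2))
    (Metric.ball_mem_nhds x₀ (half_pos hR)) ?_ ((hc x₀ hx₀).intervalIntegrable _ _) hmeas ?_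
    intervalIntegrable_const ?_).differentiableAt
  · filter_upwards [Metric.ball_mem_nhds x₀ hR] with x hx
    exact (hc x hx).aestronglyMeasurable
  · exact Filter.Eventually.of_forall fun θ _ x hx => hbound θ x hx
  · exact Filter.Eventually.of_forall fun θ _ x hx =>
      (hda θ x (Metric.ball_subset_ball (by linarith) hx)).hasFDerivAt

theorem update_mem_ball {m : ℕ} {a v : Fin m → ℂ} {r : ℝ} (hv : v ∈ Metric.ball a r) {l : Fin m}
    {ζ : ℂ} (hζ : ζ ∈ Metric.ball (a l) r) : Function.update v l ζ ∈ Metric.ball a r := by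
  have hr : 0 < r := Metric.pos_of_mem_ball hv
  rw [Metric.mem_ball, dist_pi_lt_iff hr] at hv ⊢
  intro k
  by_cases hk : k = l
  · subst hk; simpa using hζ
  · simpa [hk] using hv k

theorem differentiable_update_const {m : ℕ} (l : Fin m) (ζ : ℂ) :
    Differentiable ℂ (fun v : Fin m → ℂ => Function.update v l ζ) := by
  refine differentiable_pi.2 fun k => ?_
  by_cases hk : k = l
  · subst hk
    simp only [Function.update_self]
    exact differentiable_const ζ
  · simp only [Function.update_of_ne hk]
    exact differentiable_apply k

theorem DifferentiableOn.comp_update_const {m : ℕ} {f : (Fin m → ℂ) → ℂ} {s t : Set (Fin m → ℂ)}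
    (hf : DifferentiableOn ℂ f s) (l : Fin m) (ζ : ℂ)
    (h : ∀ v ∈ t, Function.update v l ζ ∈ s) :
    DifferentiableOn ℂ (fun v => f (Function.update v l ζ)) t := by
  have h1 : DifferentiableOn ℂ (fun v : Fin m → ℂ => Function.update v l ζ) t :=
    (differentiable_update_const l ζ).differentiableOn
  exact hf.comp h1 h

/-- Holomorphic divided differences in one of several variables. -/
theorem exists_divided_difference {m : ℕ} {f : (Fin m → ℂ) → ℂ} {a : Fin m → ℂ} {R : ℝ}
    (hf : DifferentiableOn ℂ f (Metric.ball a R)) (l : Fin m) {r : ℝ} (hr : 0 < r) (hrR : r < R) :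
    ∃ H : (Fin m → ℂ) → ℂ, DifferentiableOn ℂ H (Metric.ball a r) ∧
      ∀ v ∈ Metric.ball a r, f v - f (Function.update v l (a l)) = (v l - a l) * H v := by
  have hupd : ∀ v ∈ Metric.ball a r, ∀ ζ ∈ Metric.closedBall (a l) r,
      Function.update v l ζ ∈ Metric.closedBall a r := by
    intro v hv ζ hζ
    rw [Metric.mem_ball, dist_pi_lt_iff hr] at hv
    rw [Metric.mem_closedBall, dist_pi_le_iff hr.le]
    intro k
    by_cases hk : k = l
    · subst hk; simpa using hζ
    · simpa [hk] using (hv k).le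
  have hcb : Metric.closedBall a r ⊆ Metric.ball a R := Metric.closedBall_subset_ball hrR
  have hsl : ∀ v ∈ Metric.ball a r,
      DifferentiableOn ℂ (fun ζ => f (Function.update v l ζ)) (Metric.closedBall (a l) r) := by
    intro v hv
    refine hf.comp (g := f) (f := fun ζ => Function.update v l ζ) ?_
      fun ζ hζ => hcb (hupd v hv ζ hζ)
    exact fun ζ _ => (hasFDerivAt_update v ζ).differentiableAt.differentiableWithinAt
  obtain ⟨C, hC⟩ := (isCompact_closedBall a r).exists_bound_of_continuousOn
    (hf.continuousOn.mono hcb)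
  have hvl : ∀ v ∈ Metric.ball a r, v l ∈ Metric.ball (a l) r := fun v hv =>
    (dist_pi_lt_iff hr).1 (Metric.mem_ball.1 hv) l
  have hmc : ∀ θ, circleMap (a l) r θ ∈ Metric.closedBall (a l) r := fun θ =>
    circleMap_mem_closedBall _ hr.le θ
  have hne : ∀ v ∈ Metric.ball a r, ∀ θ, circleMap (a l) r θ - v l ≠ 0 := fun v hv θ =>
    sub_ne_zero.2 (circleMap_ne_mem_ball (hvl v hv) θ)
  have hne' : ∀ θ, circleMap (a l) r θ - a l ≠ 0 := fun θ =>
    sub_ne_zero.2 (circleMap_ne_mem_ball (Metric.mem_ball_self hr) θ)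
  have hal : a l ∈ Metric.ball (a l) r := Metric.mem_ball_self hr
  -- The difference of the Cauchy kernels at `v l` and `a l`, divided by `v l - a l`. In this
  -- product form nothing degenerates when `v l = a l`.
  let F : (Fin m → ℂ) → ℝ → ℂ := fun v θ => deriv (circleMap (a l) r) θ •
    ((circleMap (a l) r θ - v l)⁻¹ * (circleMap (a l) r θ - a l)⁻¹ *
      f (Function.update v l (circleMap (a l) r θ)))
  refine ⟨fun v => (2 * Real.pi * Complex.I : ℂ)⁻¹ * ∫ θ in (0)..(2 * Real.pi), F v θ, ?_, ?_⟩
  · intro v₀ hv₀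
    refine (DifferentiableAt.const_mul ?_ _).differentiableWithinAt
    obtain ⟨δ, hδ, hball⟩ := Metric.isOpen_ball.mem_nhds hv₀ |> Metric.mem_nhds_iff.1
    have hδ2 : Metric.ball v₀ (δ / 2) ⊆ Metric.ball v₀ δ := Metric.ball_subset_ball (by linarith)
    -- The factors of the bound are, in order, the speed `r` of the circle, the bounds for the
    -- inverse distances from the circle to `v l` and to `a l`, and the maximum `C` of `‖f‖`.
    refine differentiableAt_intervalIntegral_of_bounded (R := δ / 2)
      (M := r * ((δ / 2)⁻¹ * r⁻¹ * C)) (half_pos hδ) ?_ ?_ ?_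
    · intro θ
      have h1 : DifferentiableOn ℂ (fun v : Fin m → ℂ => circleMap (a l) r θ - v l)
          (Metric.ball v₀ (δ / 2)) := (differentiable_apply l).differentiableOn.const_sub _
      have h2 : DifferentiableOn ℂ (fun v => f (Function.update v l (circleMap (a l) r θ)))
          (Metric.ball v₀ (δ / 2)) :=
        hf.comp_update_const l _ fun v hv => hcb (hupd v (hball (hδ2 hv)) _ (hmc θ))
      exact (((h1.fun_inv fun v hv => hne v (hball (hδ2 hv)) θ).mul_const _).fun_mul
        h2).const_smul (deriv (circleMap (a l) r) θ)
    · intro v hv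
      have hv' := hball (hδ2 hv)
      have h1 : Continuous (circleMap (a l) r) := continuous_circleMap _ _
      simp only [F, deriv_circleMap]
      have h2 : Continuous fun θ => (circleMap (a l) r θ - v l)⁻¹ :=
        (h1.sub continuous_const).inv₀ (hne v hv')
      have h3 : Continuous fun θ => (circleMap (a l) r θ - a l)⁻¹ :=
        (h1.sub continuous_const).inv₀ hne'
      have h4 : Continuous fun θ => f (Function.update v l (circleMap (a l) r θ)) :=
        (hsl v hv').continuousOn.comp_continuous h1 hmc
      have h5 : Continuous fun θ => circleMap 0 r θ * Complex.I :=
        (continuous_circleMap _ _).mul continuous_const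
      exact h5.smul ((h2.mul h3).mul h4)
    · intro v hv θ
      have hv' := hball (hδ2 hv)
      have h1 : ‖f (Function.update v l (circleMap (a l) r θ))‖ ≤ C := hC _ (hupd v hv' _ (hmc θ))
      have h2 : ‖circleMap (a l) r θ - a l‖ = r := by
        simp [circleMap, abs_of_pos hr]
      -- If the point of the circle were closer to `v l`, putting it into the `l`-th slot of `v`
      -- would give a point of the ball about `v₀`, hence of the open ball of radius `r` about `a`;
      -- but its distance from `a l` is exactly `r`.
      have h3 : δ / 2 ≤ ‖circleMap (a l) r θ - v l‖ := by
        by_contra hlt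
        push Not at hlt
        have h4 : Function.update v l (circleMap (a l) r θ) ∈ Metric.ball v₀ δ := by
          rw [Metric.mem_ball]
          have h5 : dist (Function.update v l (circleMap (a l) r θ)) v < δ / 2 := by
            rw [dist_pi_lt_iff (half_pos hδ)]
            intro k
            by_cases hk : k = l
            · subst hk; simpa [dist_eq_norm] using hlt
            · simp [hk, half_pos hδ]
          have h6 := Metric.mem_ball.1 hv
          have := dist_triangle (Function.update v l (circleMap (a l) r θ)) v v₀
          linarith
        have h5 := hvl _ (hball h4)
        rw [Function.update_self, mem_ball_iff_norm, h2] at h5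
        exact lt_irrefl _ h5
      have hC0 : 0 ≤ C := (norm_nonneg _).trans h1
      simp only [F, deriv_circleMap, norm_smul, norm_mul, norm_inv, h2, Complex.norm_I, mul_one]
      rw [norm_circleMap_zero, abs_of_pos hr]
      gcongr
  · intro v hv
    have e1 := (hsl v hv).circleIntegral_sub_inv_smul (hvl v hv)
    have e2 := (hsl v hv).circleIntegral_sub_inv_smul hal
    have hpi : (2 * Real.pi * Complex.I : ℂ) ≠ 0 := Complex.two_pi_I_ne_zero
    simp only [Function.update_eq_self] at e1
    have hint : ∀ w ∈ Metric.ball (a l) r, CircleIntegrable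
        (fun z => (z - w)⁻¹ • f (Function.update v l z)) (a l) r := by
      intro w hw
      refine ContinuousOn.circleIntegrable hr.le (ContinuousOn.smul (ContinuousOn.inv₀
        (continuousOn_id.sub continuousOn_const) fun z hz => ?_) ((hsl v hv).continuousOn.mono Metric.sphere_subset_closedBall))
      refine sub_ne_zero.2 ?_
      rintro rfl
      exact (Metric.mem_ball.1 hw).ne (Metric.mem_sphere.1 hz)
    have e3 := circleIntegral.integral_sub (hint _ (hvl v hv)) (hint _ hal)
    rw [e1, e2, ← smul_sub] at e3
    have e4 : (v l - a l) * ∫ θ in (0)..(2 * Real.pi), F v θ =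
        ∮ z in C(a l, r), ((z - v l)⁻¹ • f (Function.update v l z) -
          (z - a l)⁻¹ • f (Function.update v l z)) := by
      rw [circleIntegral, ← intervalIntegral.integral_const_mul]
      refine intervalIntegral.integral_congr fun θ _ => ?_
      have h1 := hne v hv θ
      have h2 := hne' θ
      simp only [F, smul_eq_mul]
      field_simp
      ring
    rw [mul_left_comm, e4, e3, smul_eq_mul, inv_mul_cancel_left₀ hpi]

/-- **Hadamard's lemma** for holomorphic functions of several variables. -/
theorem exists_hadamard {m : ℕ} {f : (Fin m → ℂ) → ℂ} {a : Fin m → ℂ} {R : ℝ} (hR : 0 < R)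
    (hf : DifferentiableOn ℂ f (Metric.ball a R)) :
    ∃ r > 0, ∃ g : Fin m → (Fin m → ℂ) → ℂ, (∀ l, DifferentiableOn ℂ (g l) (Metric.ball a r)) ∧
      ∀ v ∈ Metric.ball a r, f v - f a = ∑ l, (v l - a l) * g l v := by
  classical
  -- Telescoping: the coordinates of `v` are replaced by those of `a` one at a time, each
  -- replacement costing one divided difference.
  suffices h : ∀ s : Finset (Fin m), ∃ r > 0, ∃ g : Fin m → (Fin m → ℂ) → ℂ,
      (∀ l, DifferentiableOn ℂ (g l) (Metric.ball a r)) ∧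
      ∀ v ∈ Metric.ball a r, f v - f (s.piecewise a v) = ∑ l ∈ s, (v l - a l) * g l v by
    obtain ⟨r, hr, g, hg, h⟩ := h Finset.univ
    exact ⟨r, hr, g, hg, fun v hv => by simpa using h v hv⟩
  intro s
  induction s using Finset.induction_on with
  | empty => exact ⟨R, hR, 0, fun _ => differentiableOn_const _, by simp⟩
  | insert l s hl ih =>
    obtain ⟨r, hr, g, hg, h⟩ := ih
    have hmin : 0 < min r R := lt_min hr hR
    obtain ⟨H, hH, hH'⟩ := exists_divided_difference hf l (r := min r R / 2) (by positivity)
      ((half_lt_self hmin).trans_le (min_le_right _ _))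
    have hsub : Metric.ball a (min r R / 2) ⊆ Metric.ball a r :=
      Metric.ball_subset_ball ((half_lt_self hmin).le.trans (min_le_left _ _))
    have hu : ∀ v ∈ Metric.ball a (min r R / 2),
        Function.update v l (a l) ∈ Metric.ball a (min r R / 2) := fun v hv =>
      update_mem_ball hv (Metric.mem_ball_self (by positivity))
    -- The divided difference needs a radius strictly below `R`. The earlier quotients are taken at
    -- the point whose `l`-th coordinate is already `a l`; this leaves their factors `v k - a k`
    -- unchanged, since `k ≠ l`.
    refine ⟨min r R / 2, by positivity,
      fun k v => if k = l then H v else g k (Function.update v l (a l)), fun k => ?_, ?_⟩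
    · by_cases hk : k = l
      · simpa [hk] using hH
      · simp only [hk, if_false]
        exact (hg k).comp_update_const l _ fun v hv => hsub (hu v hv)
    · intro v hv
      have e1 := hH' v hv
      have e2 := h _ (hsub (hu v hv))
      have e3 : s.piecewise a (Function.update v l (a l)) = (insert l s).piecewise a v := by
        funext k
        by_cases hk : k = l
        · subst hk; simp [hl]
        · by_cases hks : k ∈ s <;> simp [hk, hks]
      rw [e3] at e2
      rw [Finset.sum_insert hl]
      beta_reduce
      rw [if_pos rfl, ← e1]
      have e4 : ∑ k ∈ s, (v k - a k) * (if k = l then H v else g k (Function.update v l (a l))) =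
          ∑ k ∈ s, (Function.update v l (a l) k - a k) * g k (Function.update v l (a l)) := by
        refine Finset.sum_congr rfl fun k hk => ?_
        have hkl : k ≠ l := fun h => hl (h ▸ hk)
        simp [hkl]
      rw [e4, ← e2]
      ring

/-! ### Polynomials vanishing to high order at a point -/

open Filter Topology Asymptotics in
-- The constant coefficient is the limit at `0`, hence zero; dividing by `X` lowers the order of
-- vanishing by one, and induction takes over.
theorem Polynomial.coeff_eq_zero_of_isBigO {K : ℕ} : ∀ {r : Polynomial ℂ},
    (fun t => r.eval t) =O[𝓝[≠] (0 : ℂ)] (fun t => t ^ K) → ∀ n < K, r.coeff n = 0 := by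
  induction K with
  | zero => exact fun _ n hn => absurd hn n.not_lt_zero
  | succ K ih =>
    intro r hr n hn
    have h0 : r.coeff 0 = 0 := by
      have h1 : Tendsto (fun t : ℂ => t ^ (K + 1)) (𝓝[≠] 0) (𝓝 0) := by
        have h := (continuous_pow (M := ℂ) (K + 1)).tendsto 0
        rw [zero_pow K.succ_ne_zero] at h
        exact h.mono_left nhdsWithin_le_nhds
      have h2 : Tendsto (fun t => r.eval t) (𝓝[≠] 0) (𝓝 (r.eval 0)) :=
        (r.continuous.tendsto 0).mono_left nhdsWithin_le_nhds
      rw [Polynomial.coeff_zero_eq_eval_zero]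
      exact tendsto_nhds_unique h2 (hr.trans_tendsto h1)
    have hX : r = Polynomial.X * r.divX := by
      conv_lhs => rw [← Polynomial.X_mul_divX_add r, h0, map_zero, add_zero]
    cases n with
    | zero => exact h0
    | succ n =>
      rw [hX, Polynomial.coeff_X_mul]
      refine ih ?_ n (Nat.lt_of_succ_lt_succ hn)
      rw [isBigO_iff] at hr ⊢
      obtain ⟨c, hc⟩ := hr
      refine ⟨c, ?_⟩
      filter_upwards [hc, self_mem_nhdsWithin] with t ht ht0
      rw [hX, Polynomial.eval_mul, Polynomial.eval_X, pow_succ', norm_mul, norm_mul,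
        mul_left_comm] at ht
      exact le_of_mul_le_mul_left ht (norm_pos_iff.2 ht0)

theorem MvPolynomial.IsHomogeneous.sum_support_eq {σ R : Type*} [CommSemiring R] {n : ℕ}
    {φ : MvPolynomial σ R} (hφ : φ.IsHomogeneous n) {d : σ →₀ ℕ} (hd : d ∈ φ.support) :
    ∑ i ∈ d.support, d i = n := by
  rw [← hφ (MvPolynomial.mem_support_iff.1 hd)]
  simp [Finsupp.weight_apply, Finsupp.sum]

theorem MvPolynomial.IsHomogeneous.eval_smul_eq {σ R : Type*} [CommSemiring R] {n : ℕ}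
    {φ : MvPolynomial σ R} (hφ : φ.IsHomogeneous n) (t : R) (y : σ → R) :
    MvPolynomial.eval (t • y) φ = t ^ n * MvPolynomial.eval y φ := by
  rw [MvPolynomial.eval_eq, MvPolynomial.eval_eq, Finset.mul_sum]
  refine Finset.sum_congr rfl fun d hd => ?_
  simp only [Pi.smul_apply, smul_eq_mul, mul_pow, Finset.prod_mul_distrib]
  rw [Finset.prod_pow_eq_pow_sum, hφ.sum_support_eq hd, mul_left_comm]

open Filter Topology Asymptotics in
-- On the complex line `t ↦ t • y` the component of degree `n` becomes the coefficient of `t ^ n`,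
-- so the one-variable statement applies for every `y`.
theorem MvPolynomial.homogeneousComponent_eq_zero_of_isBigO {m K : ℕ}
    {Q : MvPolynomial (Fin m) ℂ}
    (hQ : (fun y => MvPolynomial.eval y Q) =O[𝓝 0] (fun y => ‖y‖ ^ K)) {n : ℕ} (hn : n < K) :
    MvPolynomial.homogeneousComponent n Q = 0 := by
  refine MvPolynomial.funext fun y => ?_
  rw [map_zero]
  let r : Polynomial ℂ := ∑ j ∈ Finset.range (Q.totalDegree + 1),
    Polynomial.C (MvPolynomial.eval y (MvPolynomial.homogeneousComponent j Q)) * Polynomial.X ^ j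
  have hr : ∀ t, r.eval t = MvPolynomial.eval (t • y) Q := by
    intro t
    conv_rhs => rw [← MvPolynomial.sum_homogeneousComponent Q]
    rw [map_sum, Polynomial.eval_finsetSum]
    refine Finset.sum_congr rfl fun j _ => ?_
    rw [(MvPolynomial.homogeneousComponent_isHomogeneous j Q).eval_smul_eq]
    rw [mul_comm, Polynomial.eval_mul, Polynomial.eval_pow, Polynomial.eval_X, Polynomial.eval_C]
  have ht : Tendsto (fun t : ℂ => t • y) (𝓝[≠] 0) (𝓝 0) := by
    have h : Continuous fun t : ℂ => t • y := continuous_id.smul continuous_const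
    have h' := h.tendsto 0
    rw [zero_smul] at h'
    exact h'.mono_left nhdsWithin_le_nhds
  have hO : (fun t => r.eval t) =O[𝓝[≠] (0 : ℂ)] (fun t => t ^ K) := by
    refine ((hQ.comp_tendsto ht).congr_left fun t => (hr t).symm).trans ?_
    refine IsBigO.of_bound (‖y‖ ^ K) (Eventually.of_forall fun t => ?_)
    simp only [Function.comp_apply, norm_pow, norm_smul, mul_pow, norm_mul, norm_norm]
    rw [mul_comm]
  have hcoeff := Polynomial.coeff_eq_zero_of_isBigO hO n hn
  by_cases hd : n < Q.totalDegree + 1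
  · simpa [r, Polynomial.finsetSum_coeff, Polynomial.coeff_C_mul, Polynomial.coeff_X_pow, hd]
      using hcoeff
  · rw [MvPolynomial.homogeneousComponent_eq_zero _ _ (by omega), map_zero]

open Filter Topology Asymptotics in
/-- A polynomial vanishing to sufficiently high order at `a` vanishes at every point which is an
infinitesimal perturbation of `a`. -/
theorem MvPolynomial.exists_aeval_eq_zero_of_isBigO {m : ℕ} {A : Type*} [CommRing A] [Algebra ℂ A]
    {a : Fin m → ℂ} {w : Fin m → A} (hw : ∀ l, IsNilpotent (w l - algebraMap ℂ A (a l))) :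
    ∃ K : ℕ, ∀ P : MvPolynomial (Fin m) ℂ,
      (fun z => MvPolynomial.eval z P) =O[𝓝 a] (fun z => ‖z - a‖ ^ K) →
        MvPolynomial.aeval w P = 0 := by
  -- Finitely many nilpotents generate a nilpotent ideal in a commutative ring; its exponent is the
  -- required order `K`.
  let I : Ideal A := Ideal.span (Set.range fun l => w l - algebraMap ℂ A (a l))
  obtain ⟨K, hK⟩ : IsNilpotent I := by
    refine (Ideal.FG.isNilpotent_iff_le_nilradical
      (Submodule.fg_span (Set.finite_range _))).2 (Ideal.span_le.2 ?_)
    rintro _ ⟨l, rfl⟩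
    exact mem_nilradical.2 (hw l)
  refine ⟨K, fun P hP => ?_⟩
  let Q : MvPolynomial (Fin m) ℂ :=
    MvPolynomial.aeval (fun l => MvPolynomial.X l + MvPolynomial.C (a l)) P
  have hQeval : ∀ y, MvPolynomial.eval y Q = MvPolynomial.eval (y + a) P := by
    intro y
    have h : (MvPolynomial.aeval y).comp (MvPolynomial.aeval fun l =>
        (MvPolynomial.X l + MvPolynomial.C (a l) : MvPolynomial (Fin m) ℂ)) =
        (MvPolynomial.aeval (y + a) : MvPolynomial (Fin m) ℂ →ₐ[ℂ] ℂ) := by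
      ext l
      simp
    have h' := AlgHom.congr_fun h P
    rw [AlgHom.comp_apply, MvPolynomial.aeval_eq_eval, MvPolynomial.aeval_eq_eval] at h'
    exact h'
  have hQw : MvPolynomial.aeval (fun l => w l - algebraMap ℂ A (a l)) Q =
      MvPolynomial.aeval w P := by
    have h : (MvPolynomial.aeval fun l => w l - algebraMap ℂ A (a l)).comp
        (MvPolynomial.aeval fun l =>
          (MvPolynomial.X l + MvPolynomial.C (a l) : MvPolynomial (Fin m) ℂ)) =
        (MvPolynomial.aeval w : MvPolynomial (Fin m) ℂ →ₐ[ℂ] A) := by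
      ext l
      simp
    exact AlgHom.congr_fun h P
  have hO : (fun y => MvPolynomial.eval y Q) =O[𝓝 0] (fun y => ‖y‖ ^ K) := by
    have ht : Tendsto (fun y : Fin m → ℂ => y + a) (𝓝 0) (𝓝 a) := by
      have h : Continuous fun y : Fin m → ℂ => y + a := continuous_id.add continuous_const
      have h' := h.tendsto 0
      rwa [zero_add] at h'
    refine ((hP.comp_tendsto ht).congr (fun y => (hQeval y).symm) fun y => ?_)
    simp
  rw [← hQw, ← MvPolynomial.sum_homogeneousComponent Q, map_sum]
  refine Finset.sum_eq_zero fun n _ => ?_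
  -- In the expansion `Q` of `P` about `a`, components of degree below `K` vanish by the growth
  -- condition, while the others take values in `I ^ K = 0`.
  by_cases hn : n < K
  · rw [MvPolynomial.homogeneousComponent_eq_zero_of_isBigO hO hn, map_zero]
  · have hhom := MvPolynomial.homogeneousComponent_isHomogeneous n Q
    rw [MvPolynomial.aeval_def, MvPolynomial.eval₂_eq]
    refine Finset.sum_eq_zero fun d hd => ?_
    have hdeg := hhom.sum_support_eq hd
    have hmem : ∏ i ∈ d.support, (w i - algebraMap ℂ A (a i)) ^ d i ∈ I ^ n := by
      rw [← hdeg, ← Finset.prod_pow_eq_pow_sum]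
      exact Ideal.prod_mem_prod fun i _ =>
        Ideal.pow_mem_pow (Ideal.subset_span (Set.mem_range_self i)) _
    have h0 := Ideal.pow_le_pow_right (not_lt.1 hn) hmem
    rw [hK] at h0
    rw [Ideal.mem_bot.1 h0, mul_zero]

/-! ### Homomorphisms out of the algebra of functions holomorphic near a point -/

/-- Since `α` is onto modulo `I`, the quotient `S ⧸ I` is also a quotient of `R`, and `β` factors
through it. In the application `R` consists of polynomials, `S` of holomorphic functions, and `I` of
functions vanishing to high order. -/
theorem AlgHom.exists_comp_eq_of_ideal {k R S A : Type*} [CommRing k] [CommRing R] [CommRing S]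
    [CommRing A] [Algebra k R] [Algebra k S] [Algebra k A] (I : Ideal S) (α : R →ₐ[k] S)
    (β : R →ₐ[k] A) (hα : ∀ s, ∃ r, s - α r ∈ I) (h : ∀ r, α r ∈ I → β r = 0) :
    ∃ e : S →ₐ[k] A, e.comp α = β ∧ ∀ s ∈ I, e s = 0 := by
  let π : R →ₐ[k] S ⧸ I := (Ideal.Quotient.mkₐ k I).comp α
  have hπ : Function.Surjective π := by
    intro x
    obtain ⟨s, rfl⟩ := Ideal.Quotient.mk_surjective x
    obtain ⟨r, hr⟩ := hα s
    exact ⟨r, (Ideal.Quotient.eq.2 hr).symm⟩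
  have hker : RingHom.ker π.toRingHom ≤ RingHom.ker β.toRingHom :=
    fun r hr => h r (Ideal.Quotient.eq_zero_iff_mem.1 hr)
  refine ⟨(AlgHom.liftOfSurjective π hπ β hker).comp (Ideal.Quotient.mkₐ k I),
    AlgHom.ext fun r => AlgHom.liftOfSurjective_apply π hπ β hker r, fun s hs => ?_⟩
  have h2 : Ideal.Quotient.mkₐ k I s = 0 := Ideal.Quotient.eq_zero_iff_mem.2 hs
  rw [AlgHom.comp_apply, h2, map_zero]

open Filter Topology in
/-- The algebra of functions that are holomorphic in a neighbourhood of `a`. -/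
def holoNear {m : ℕ} (a : Fin m → ℂ) : Subalgebra ℂ ((Fin m → ℂ) → ℂ) where
  carrier := {f | ∀ᶠ z in 𝓝 a, DifferentiableAt ℂ f z}
  mul_mem' hf hg := by
    filter_upwards [hf, hg] with z h1 h2
    exact h1.mul h2
  add_mem' hf hg := by
    filter_upwards [hf, hg] with z h1 h2
    exact h1.add h2
  algebraMap_mem' c := Eventually.of_forall fun z => differentiableAt_const c

namespace holoNear

open Filter Topology Asymptotics

variable {m : ℕ} {a : Fin m → ℂ}

/-- The coordinate functions. -/
def coord (a : Fin m → ℂ) (l : Fin m) : holoNear a :=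
  ⟨fun z => z l, Eventually.of_forall fun z => differentiable_apply l z⟩

theorem mem_of_eventuallyEq {f g : (Fin m → ℂ) → ℂ} (hf : f ∈ holoNear a) (h : g =ᶠ[𝓝 a] f) :
    g ∈ holoNear a := by
  filter_upwards [hf, h.eventually_nhds] with z h1 h2
  exact h1.congr_of_eventuallyEq h2

theorem mem_of_differentiableOn {f : (Fin m → ℂ) → ℂ} {U : Set (Fin m → ℂ)} (hU : U ∈ 𝓝 a)
    (hf : DifferentiableOn ℂ f U) : f ∈ holoNear a := by
  filter_upwards [eventually_mem_nhds_iff.2 hU] with z hz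
  exact hf.differentiableAt hz

/-- Hadamard's lemma as an identity inside the algebra. Its elements are functions on all of `ℂ^m`
rather than germs, so the identity must also hold far from `a`. There `∑ |z_l - a_l|²` is nonzero
and conjugate coordinates serve as quotients, holomorphy being required only near `a`. -/
theorem exists_sub_eq_sum (f : holoNear a) : ∃ g : Fin m → holoNear a,
    f - algebraMap ℂ _ (f.1 a) = ∑ l, (coord a l - algebraMap ℂ _ (a l)) * g l := by
  classical
  obtain ⟨R, hR, hf⟩ := Metric.eventually_nhds_iff_ball.1 f.2
  obtain ⟨r, hr, g, hg, h⟩ := exists_hadamard hR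
    fun z hz => (hf z hz).differentiableWithinAt
  have hnear : Metric.ball a r ∈ 𝓝 a := Metric.ball_mem_nhds a hr
  -- outside the ball, where some coordinate differs from that of `a`, divide by hand
  let q : (Fin m → ℂ) → ℂ := fun z => ∑ l, (z l - a l) * starRingEnd ℂ (z l - a l)
  let G : Fin m → (Fin m → ℂ) → ℂ := fun l z => if z ∈ Metric.ball a r then g l z else
    (f.1 z - f.1 a) * starRingEnd ℂ (z l - a l) / q z
  have hG : ∀ l, G l ∈ holoNear a := fun l =>
    mem_of_eventuallyEq (mem_of_differentiableOn hnear (hg l)) <| by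
      filter_upwards [hnear] with z hz
      simp only [G, hz, if_true]
  refine ⟨fun l => ⟨G l, hG l⟩, Subtype.ext (funext fun z => ?_)⟩
  have hsum : ((∑ l, (coord a l - algebraMap ℂ _ (a l)) * (⟨G l, hG l⟩ : holoNear a) :
      holoNear a) : (Fin m → ℂ) → ℂ) z = ∑ l, (z l - a l) * G l z := by
    rw [AddSubmonoidClass.coe_finsetSum, Finset.sum_apply]
    rfl
  rw [hsum]
  change f.1 z - f.1 a = _
  by_cases hz : z ∈ Metric.ball a r
  · simp only [G, hz, if_true]
    exact h z hz
  · simp only [G, hz, if_false]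
    have hq : q z ≠ 0 := by
      have hq' : q z = ((∑ l, Complex.normSq (z l - a l) : ℝ) : ℂ) := by
        simp only [q, Complex.mul_conj, Complex.ofReal_sum]
      rw [hq', Complex.ofReal_ne_zero]
      intro h0
      rw [Finset.sum_eq_zero_iff_of_nonneg fun l _ => Complex.normSq_nonneg _] at h0
      refine hz ?_
      have : z = a := funext fun l =>
        sub_eq_zero.1 (Complex.normSq_eq_zero.1 (h0 l (Finset.mem_univ l)))
      rw [this]
      exact Metric.mem_ball_self hr
    have : ∀ l, (z l - a l) * ((f.1 z - f.1 a) * starRingEnd ℂ (z l - a l) / q z) =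
        (f.1 z - f.1 a) / q z * ((z l - a l) * starRingEnd ℂ (z l - a l)) := fun l => by ring
    rw [Finset.sum_congr rfl fun l _ => this l, ← Finset.mul_sum]
    exact (div_mul_cancel₀ _ hq).symm

/-- The ideal generated by the differences of the coordinates and their values at `a`. -/
def coordIdeal (a : Fin m → ℂ) : Ideal (holoNear a) :=
  Ideal.span (Set.range fun l => coord a l - algebraMap ℂ _ (a l))

/-- Taylor expansion without derivatives: applying the induction hypothesis to the Hadamard
quotients gains one more factor from the ideal. -/
theorem exists_sub_aeval_mem (K : ℕ) : ∀ f : holoNear a, ∃ P : MvPolynomial (Fin m) ℂ,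
    f - MvPolynomial.aeval (coord a) P ∈ coordIdeal a ^ K := by
  induction K with
  | zero => exact fun f => ⟨0, by simp⟩
  | succ K ih =>
    intro f
    obtain ⟨g, hg⟩ := exists_sub_eq_sum f
    choose P hP using fun l => ih (g l)
    refine ⟨MvPolynomial.C (f.1 a) + ∑ l, (MvPolynomial.X l - MvPolynomial.C (a l)) * P l, ?_⟩
    have h : f - MvPolynomial.aeval (coord a)
        (MvPolynomial.C (f.1 a) + ∑ l, (MvPolynomial.X l - MvPolynomial.C (a l)) * P l) =
        ∑ l, (coord a l - algebraMap ℂ _ (a l)) *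
          (g l - MvPolynomial.aeval (coord a) (P l)) := by
      simp only [mul_sub, Finset.sum_sub_distrib, ← hg, map_add, map_sum, map_mul, map_sub,
        MvPolynomial.aeval_X, MvPolynomial.aeval_C]
      abel
    rw [h, pow_succ']
    exact Ideal.sum_mem _ fun l _ =>
      Ideal.mul_mem_mul (Ideal.subset_span (Set.mem_range_self l)) (hP l)

/-- The ideal is finitely generated and its generators have nilpotent images, so each homomorphism
kills a power of it; modulo a common power every function is a polynomial in the coordinates. -/
theorem algHom_ext {A : Type*} [Ring A] [Algebra ℂ A] {φ ψ : holoNear a →ₐ[ℂ] A}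
    (hφ : ∀ l, IsNilpotent (φ (coord a l) - algebraMap ℂ A (a l)))
    (h : ∀ l, φ (coord a l) = ψ (coord a l)) : φ = ψ := by
  have key : ∀ χ : holoNear a →ₐ[ℂ] A,
      (∀ l, IsNilpotent (χ (coord a l) - algebraMap ℂ A (a l))) →
      ∃ K, coordIdeal a ^ K ≤ RingHom.ker χ := by
    intro χ hχ
    refine Ideal.exists_pow_le_of_le_radical_of_fg (Ideal.span_le.2 ?_)
      (Submodule.fg_span (Set.finite_range _))
    rintro _ ⟨l, rfl⟩
    obtain ⟨n, hn⟩ := hχ l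
    refine ⟨n, ?_⟩
    rw [RingHom.mem_ker, map_pow, map_sub, AlgHom.commutes, hn]
  obtain ⟨K₁, h₁⟩ := key φ hφ
  obtain ⟨K₂, h₂⟩ := key ψ fun l => h l ▸ hφ l
  ext f
  obtain ⟨P, hP⟩ := exists_sub_aeval_mem (max K₁ K₂) f
  have e1 := h₁ (Ideal.pow_le_pow_right (le_max_left _ _) hP)
  have e2 := h₂ (Ideal.pow_le_pow_right (le_max_right _ _) hP)
  rw [RingHom.mem_ker, map_sub, sub_eq_zero] at e1 e2
  rw [e1, e2]
  have : φ.comp (MvPolynomial.aeval (coord a)) = ψ.comp (MvPolynomial.aeval (coord a)) := by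
    ext l
    simpa using h l
  exact AlgHom.congr_fun this P

/-- The ideal of functions vanishing at `a` to order `K`. -/
def orderIdeal (a : Fin m → ℂ) (K : ℕ) : Ideal (holoNear a) where
  carrier := {f | f.1 =O[𝓝 a] fun z => ‖z - a‖ ^ K}
  add_mem' hf hg := hf.add hg
  zero_mem' := isBigO_zero _ _
  smul_mem' g f hf := by
    have h1 : g.1 =O[𝓝 a] fun _ => (1 : ℝ) :=
      g.2.self_of_nhds.continuousAt.tendsto.isBigO_one ℝ
    have h2 := h1.mul hf
    simp only [one_mul] at h2
    exact h2

/-- Makes Taylor expansion available modulo `orderIdeal`. Membership in that ideal is an analytic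
condition: it can be tested on polynomials, and it holds for every function vanishing near `a`. -/
theorem coordIdeal_pow_le (K : ℕ) : coordIdeal a ^ K ≤ orderIdeal a K := by
  induction K with
  | zero =>
    intro f _
    have h1 : f.1 =O[𝓝 a] fun _ => (1 : ℝ) :=
      f.2.self_of_nhds.continuousAt.tendsto.isBigO_one ℝ
    change f.1 =O[𝓝 a] fun z => ‖z - a‖ ^ 0
    simpa only [pow_zero] using h1
  | succ K ih =>
    rw [pow_succ', Ideal.mul_le]
    intro f hf g hg
    have h1 : f ∈ orderIdeal a 1 := by
      refine Ideal.span_le.2 ?_ hf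
      rintro _ ⟨l, rfl⟩
      refine IsBigO.of_norm_le fun z => ?_
      rw [pow_one]
      exact norm_le_pi_norm (z - a) l
    have h2 := IsBigO.mul h1 (ih hg)
    refine h2.congr_right fun z => ?_
    rw [pow_one, pow_succ']

/-- Modulo functions of vanishing order `K` every function is a polynomial, and for suitable `K` the
polynomials of that order vanish at `w`. Hence polynomial evaluation at `w` extends. -/
theorem exists_algHom {A : Type*} [CommRing A] [Algebra ℂ A] {w : Fin m → A}
    (hw : ∀ l, IsNilpotent (w l - algebraMap ℂ A (a l))) :
    ∃ e : holoNear a →ₐ[ℂ] A, (∀ l, e (coord a l) = w l) ∧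
      ∀ f : holoNear a, f.1 =ᶠ[𝓝 a] 0 → e f = 0 := by
  obtain ⟨K, hK⟩ := MvPolynomial.exists_aeval_eq_zero_of_isBigO hw
  have heval : ∀ P : MvPolynomial (Fin m) ℂ, ∀ z,
      (MvPolynomial.aeval (coord a) P : holoNear a).1 z = MvPolynomial.eval z P := by
    intro P z
    have h : ((Pi.evalAlgHom ℂ (fun _ : Fin m → ℂ => ℂ) z).comp (holoNear a).val).comp
        (MvPolynomial.aeval (coord a)) = MvPolynomial.aeval z := by
      ext l
      simp [coord]
    have h' := AlgHom.congr_fun h P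
    rw [MvPolynomial.aeval_eq_eval] at h'
    exact h'
  obtain ⟨e, he, he'⟩ := AlgHom.exists_comp_eq_of_ideal (orderIdeal a K)
    (MvPolynomial.aeval (coord a)) (MvPolynomial.aeval w)
    (fun f => (exists_sub_aeval_mem K f).imp fun P hP => coordIdeal_pow_le K hP)
    fun P hP => hK P (IsBigO.congr_left hP fun z => heval P z)
  refine ⟨e, fun l => ?_, fun f hf =>
    he' f ((isBigO_zero _ _).congr' hf.symm EventuallyEq.rfl)⟩
  have h := AlgHom.congr_fun he (MvPolynomial.X l)
  rwa [AlgHom.comp_apply, MvPolynomial.aeval_X, MvPolynomial.aeval_X] at h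

end holoNear

/-! ### Nilpotents, units and odd substitutions in Grassmann algebras -/

namespace SuperGeometry

theorem body_add {n : ℕ} (a b : Grassmann n) : body (a + b) = body a + body b := map_add _ a b
theorem body_sub {n : ℕ} (a b : Grassmann n) : body (a - b) = body a - body b := map_sub _ a b
theorem body_mul {n : ℕ} (a b : Grassmann n) : body (a * b) = body a * body b := map_mul _ a b
theorem body_one {n : ℕ} : body (1 : Grassmann n) = 1 := map_one _
theorem body_algebraMap {n : ℕ} (c : ℂ) : body (algebraMap ℂ (Grassmann n) c) = c :=
  AlgHom.commutes _ c
theorem body_ι {n : ℕ} (m : Fin n → ℂ) : body (ExteriorAlgebra.ι ℂ m) = 0 := by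
  simp [body, ExteriorAlgebra.algebraMapInv]

theorem commute_of_even {n : ℕ} {a : Grassmann n} (ha : a ∈ gParity n 0) (b : Grassmann n) :
    Commute a b := by
  have h : ∀ (i : ZMod 2) (c : Grassmann n), c ∈ gParity n i → Commute a c := by
    intro i c hc
    have := gParity_superComm ha hc
    rwa [ZMod.val_zero, zero_mul, pow_zero, one_smul] at this
  have h1 := (h 0 _ (evenProj_mem b).1).add_right (h 1 _ (evenProj_mem b).2)
  rwa [add_sub_cancel] at h1

theorem mul_self_of_odd {n : ℕ} {a : Grassmann n} (ha : a ∈ gParity n 1) : a * a = 0 := by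
  have h := gParity_superComm ha ha
  rw [ZMod.val_one, mul_one, pow_one, neg_one_smul] at h
  have h2 : (2 : ℂ) • (a * a) = 0 := by
    rw [two_smul]
    nth_rewrite 1 [h]
    exact neg_add_cancel _
  exact (smul_eq_zero.1 h2).resolve_left two_ne_zero

theorem ι_mem_gParity {n : ℕ} (m : Fin n → ℂ) : ExteriorAlgebra.ι ℂ m ∈ gParity n 1 :=
  CliffordAlgebra.ι_mem_evenOdd_one _ m

/-- A product of two generating vectors is central with square zero, so all its multiples are
nilpotent; sums of commuting nilpotents are nilpotent. -/
theorem isNilpotent_sub_body_of_even {n : ℕ} {a : Grassmann n} (ha : a ∈ gParity n 0) :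
    IsNilpotent (a - algebraMap ℂ _ (body a)) := by
  refine CliffordAlgebra.even_induction (0 : QuadraticForm ℂ (Fin n → ℂ))
    (motive := fun x _ => IsNilpotent ((x : Grassmann n) - algebraMap ℂ _ (body x)))
    ?_ ?_ ?_ a ha
  · intro r
    have h := body_algebraMap (n := n) r
    exact (congrArg (fun c => (algebraMap ℂ (Grassmann n) r) - algebraMap ℂ _ c) h).trans
      (sub_self _) ▸ IsNilpotent.zero
  · intro x y hx hy h1 h2
    have e : (x + y : Grassmann n) - algebraMap ℂ _ (body (x + y)) =
        (x - algebraMap ℂ _ (body x)) + (y - algebraMap ℂ _ (body y)) := by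
      rw [body_add, map_add]
      abel
    have hc : Commute ((x : Grassmann n) - algebraMap ℂ _ (body x))
        (y - algebraMap ℂ _ (body y)) :=
      (commute_of_even hx _).sub_left (Algebra.commutes _ _)
    rw [e]
    exact hc.isNilpotent_add h1 h2
  · intro m₁ m₂ x hx _
    have hb : body (ExteriorAlgebra.ι ℂ m₁ * ExteriorAlgebra.ι ℂ m₂ * x : Grassmann n) = 0 := by
      rw [body_mul, body_mul, body_ι, zero_mul, zero_mul]
    have h12 : (ExteriorAlgebra.ι ℂ m₁ * ExteriorAlgebra.ι ℂ m₂ : Grassmann n) ∈ gParity n 0 := by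
      have := gParity_mul_mem (ι_mem_gParity m₁) (ι_mem_gParity m₂)
      rwa [show (1 + 1 : ZMod 2) = 0 from rfl] at this
    have hsq : (ExteriorAlgebra.ι ℂ m₁ * ExteriorAlgebra.ι ℂ m₂ *
        (ExteriorAlgebra.ι ℂ m₁ * ExteriorAlgebra.ι ℂ m₂) : Grassmann n) = 0 := by
      rw [← mul_assoc, (commute_of_even h12 (ExteriorAlgebra.ι ℂ m₁)).eq, ← mul_assoc,
        mul_self_of_odd (ι_mem_gParity m₁), zero_mul, zero_mul]
    change IsNilpotent ((ExteriorAlgebra.ι ℂ m₁ * ExteriorAlgebra.ι ℂ m₂ * x : Grassmann n) -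
      algebraMap ℂ _ (body (ExteriorAlgebra.ι ℂ m₁ * ExteriorAlgebra.ι ℂ m₂ * x : Grassmann n)))
    rw [hb, map_zero, sub_zero]
    refine (commute_of_even h12 x).isNilpotent_mul_right ⟨2, ?_⟩
    rw [pow_two, hsq]

/-- The odd part squares to zero, so its body vanishes; then the even part has zero body too, and
the two commuting parts are both nilpotent. -/
theorem isNilpotent_of_body_eq_zero {n : ℕ} {a : Grassmann n} (ha : body a = 0) :
    IsNilpotent a := by
  obtain ⟨h0, h1⟩ := evenProj_mem a
  have hodd : body (a - evenProj n a) = 0 := by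
    have h := congrArg body (mul_self_of_odd h1)
    rw [body_mul, show body (0 : Grassmann n) = 0 from map_zero _] at h
    exact mul_self_eq_zero.1 h
  have heven : body (evenProj n a) = 0 := by
    rwa [body_sub, ha, zero_sub, neg_eq_zero] at hodd
  have h2 := isNilpotent_sub_body_of_even h0
  rw [heven, map_zero, sub_zero] at h2
  have h3 : IsNilpotent (a - evenProj n a) := ⟨2, by rw [pow_two, mul_self_of_odd h1]⟩
  have h4 := (commute_of_even h0 (a - evenProj n a)).isNilpotent_add h2 h3
  rwa [add_sub_cancel] at h4

instance (n : ℕ) : Module.Finite ℂ (Grassmann n) :=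
  Module.Finite.of_basis (Pi.basisFun ℂ (Fin n)).ExteriorAlgebra

/-- A uniform exponent is needed because a section is a whole family of Grassmann elements and is
nilpotent only if one power kills all its values. The kernels of powers of a multiplication operator
stabilise by the dimension of the algebra. -/
theorem exists_pow_eq_zero (n : ℕ) : ∃ k, ∀ a : Grassmann n, body a = 0 → a ^ k = 0 := by
  refine ⟨Module.finrank ℂ (Grassmann n), fun a ha => ?_⟩
  obtain ⟨k, hk⟩ := isNilpotent_of_body_eq_zero ha
  have h1 := Module.End.ker_pow_le_ker_pow_finrank (LinearMap.mulLeft ℂ a) k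
  have h2 : (1 : Grassmann n) ∈ LinearMap.ker (LinearMap.mulLeft ℂ a ^ k) := by
    rw [LinearMap.mem_ker, LinearMap.pow_mulLeft, hk, LinearMap.mulLeft_apply, zero_mul]
  have h3 := h1 h2
  rwa [LinearMap.mem_ker, LinearMap.pow_mulLeft, LinearMap.mulLeft_apply, mul_one] at h3

theorem not_isUnit_of_body_eq_zero {n : ℕ} {a : Grassmann n} (ha : body a = 0) : ¬ IsUnit a :=
  fun h => (h.map (ExteriorAlgebra.algebraMapInv (R := ℂ) (M := Fin n → ℂ))).ne_zero ha

/-- The even part of the Grassmann algebra is commutative. -/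
noncomputable abbrev evenPartCommRing (N : ℕ) : CommRing (evenPart N) :=
  { (inferInstance : Ring (evenPart N)) with
    mul_comm := fun a b => Subtype.ext (commute_of_even a.2 b).eq }

theorem evenPart_isNilpotent_sub_body {N : ℕ} (a : evenPart N) :
    IsNilpotent (a - algebraMap ℂ (evenPart N) (body (a : Grassmann N))) := by
  obtain ⟨k, hk⟩ := isNilpotent_sub_body_of_even a.2
  exact ⟨k, Subtype.ext hk⟩

/-- An even element is its body plus a nilpotent. Thus `nonUnits` consists of the even elements with
zero body, and invertibility of a coordinate becomes a condition on the image point. -/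
theorem evenPart_isUnit_iff {N : ℕ} (a : evenPart N) :
    IsUnit a ↔ body (a : Grassmann N) ≠ 0 := by
  constructor
  · exact fun h h0 => not_isUnit_of_body_eq_zero h0 (h.map (evenPart N).val)
  · intro h
    have h1 : IsUnit (algebraMap ℂ (evenPart N) (body (a : Grassmann N))) :=
      (IsUnit.mk0 _ h).map (algebraMap ℂ (evenPart N))
    have h2 := (evenPart_isNilpotent_sub_body a).isUnit_add_left_of_commute h1
      (Subtype.ext (commute_of_even (Subtype.mem _) _).eq)
    rwa [add_sub_cancel] at h2

/-- Substitution of odd elements of `Γ_N` for the generators of `Γ_q`. -/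
noncomputable def oddSubst {N q : ℕ} (ξ : Fin q → oddPart N) : Grassmann q →ₐ[ℂ] Grassmann N :=
  ExteriorAlgebra.lift ℂ ⟨(oddPart N).subtype ∘ₗ Fintype.linearCombination ℂ ξ,
    fun m => mul_self_of_odd (Fintype.linearCombination ℂ ξ m).2⟩

theorem oddSubst_ι {N q : ℕ} (ξ : Fin q → oddPart N) (m : Fin q → ℂ) :
    oddSubst ξ (ExteriorAlgebra.ι ℂ m) = (Fintype.linearCombination ℂ ξ m : oddPart N) :=
  ExteriorAlgebra.lift_ι_apply _ _ _ m

theorem oddSubst_gen {N q : ℕ} (ξ : Fin q → oddPart N) (r : Fin q) :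
    oddSubst ξ (Grassmann.gen r) = ξ r := by
  rw [Grassmann.gen, oddSubst_ι, Fintype.linearCombination_apply_single, one_smul]

theorem body_oddSubst {N q : ℕ} (ξ : Fin q → oddPart N) (x : Grassmann q) :
    body (oddSubst ξ x) = body x := by
  have h : (ExteriorAlgebra.algebraMapInv (R := ℂ) (M := Fin N → ℂ)).comp (oddSubst ξ) =
      ExteriorAlgebra.algebraMapInv (R := ℂ) (M := Fin q → ℂ) := by
    refine ExteriorAlgebra.hom_ext (LinearMap.ext fun m => ?_)
    have h1 := body_ι m
    have h2 : body (oddSubst ξ (ExteriorAlgebra.ι ℂ m)) = 0 := by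
      refine mul_self_eq_zero.1 ?_
      rw [← body_mul, oddSubst_ι, mul_self_of_odd (Fintype.linearCombination ℂ ξ m).2]
      exact map_zero _
    exact h2.trans h1.symm
  exact AlgHom.congr_fun h x

theorem oddSubst_mem {N q : ℕ} (ξ : Fin q → oddPart N) {i : ZMod 2} {x : Grassmann q}
    (hx : x ∈ gParity q i) : oddSubst ξ x ∈ gParity N i := by
  have hι : ∀ m, oddSubst ξ (ExteriorAlgebra.ι ℂ m) ∈ gParity N 1 := fun m => by
    rw [oddSubst_ι]
    exact (Fintype.linearCombination ℂ ξ m).2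
  have key : ∀ i m₁ m₂ (x : Grassmann q), oddSubst ξ x ∈ gParity N i →
      oddSubst ξ (ExteriorAlgebra.ι ℂ m₁ * ExteriorAlgebra.ι ℂ m₂ * x) ∈ gParity N i := by
    intro i m₁ m₂ x hx
    rw [map_mul, map_mul]
    have := gParity_mul_mem (gParity_mul_mem (hι m₁) (hι m₂)) hx
    rwa [show (1 + 1 : ZMod 2) = 0 from rfl, zero_add] at this
  obtain rfl | rfl : i = 0 ∨ i = 1 := (by decide : ∀ k : ZMod 2, k = 0 ∨ k = 1) i
  · refine CliffordAlgebra.even_induction (0 : QuadraticForm ℂ (Fin q → ℂ))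
      (motive := fun x _ => oddSubst ξ x ∈ gParity N 0) ?_ ?_ ?_ x hx
    · intro r
      have h : oddSubst ξ (algebraMap ℂ (Grassmann q) r) = algebraMap ℂ _ r :=
        AlgHom.commutes _ r
      exact h ▸ (evenPart N).algebraMap_mem r
    · intro x y _ _ h1 h2
      exact (map_add (oddSubst ξ) x y) ▸ Submodule.add_mem _ h1 h2
    · intro m₁ m₂ x _ h
      exact key 0 m₁ m₂ x h
  · refine CliffordAlgebra.odd_induction (0 : QuadraticForm ℂ (Fin q → ℂ))
      (P := fun x _ => oddSubst ξ x ∈ gParity N 1) ?_ ?_ ?_ x hx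
    · exact hι
    · intro x y _ _ h1 h2
      exact (map_add (oddSubst ξ) x y) ▸ Submodule.add_mem _ h1 h2
    · intro m₁ m₂ x _ h
      exact key 1 m₁ m₂ x h

end SuperGeometry

/-! ### Substitution of Grassmann elements into holomorphic superfunctions -/

namespace SuperGeometry
open Filter Topology

/-- The vector of bodies of a vector of even elements. -/
noncomputable def bodyVec {m N : ℕ} (w : Fin m → evenPart N) : Fin m → ℂ :=
  fun l => body (w l : Grassmann N)

theorem exists_germEval {m N : ℕ} (w : Fin m → evenPart N) :
    ∃ e : holoNear (bodyVec w) →ₐ[ℂ] evenPart N, (∀ l, e (holoNear.coord _ l) = w l) ∧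
      ∀ f : holoNear (bodyVec w), f.1 =ᶠ[𝓝 (bodyVec w)] 0 → e f = 0 :=
  letI := evenPartCommRing N
  holoNear.exists_algHom fun l => evenPart_isNilpotent_sub_body (w l)

/-- Substitution of even elements of the Grassmann algebra into holomorphic functions. -/
noncomputable def germEval {m N : ℕ} (w : Fin m → evenPart N) :
    holoNear (bodyVec w) →ₐ[ℂ] evenPart N :=
  (exists_germEval w).choose

theorem germEval_coord {m N : ℕ} (w : Fin m → evenPart N) (l : Fin m) :
    germEval w (holoNear.coord _ l) = w l :=
  (exists_germEval w).choose_spec.1 l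

theorem germEval_congr {m N : ℕ} (w : Fin m → evenPart N) {f g : holoNear (bodyVec w)}
    (h : f.1 =ᶠ[𝓝 (bodyVec w)] g.1) : germEval w f = germEval w g := by
  rw [← sub_eq_zero, ← map_sub]
  refine (exists_germEval w).choose_spec.2 _ ?_
  filter_upwards [h] with z hz
  exact sub_eq_zero.2 hz

/-- By Hadamard's lemma `f - f(a)` is a combination of the `z_l - a_l`, and these go to elements
with zero body. -/
theorem body_germEval {m N : ℕ} (w : Fin m → evenPart N) (f : holoNear (bodyVec w)) :
    body (germEval w f : Grassmann N) = f.1 (bodyVec w) := by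
  let β : holoNear (bodyVec w) →ₐ[ℂ] ℂ :=
    ((ExteriorAlgebra.algebraMapInv (R := ℂ) (M := Fin N → ℂ)).comp (evenPart N).val).comp
      (germEval w)
  obtain ⟨g, hg⟩ := holoNear.exists_sub_eq_sum f
  have h : β (f - algebraMap ℂ _ (f.1 (bodyVec w))) = 0 := by
    rw [hg, map_sum]
    refine Finset.sum_eq_zero fun l _ => ?_
    rw [map_mul, map_sub, AlgHom.commutes]
    have : β (holoNear.coord _ l) = bodyVec w l :=
      congrArg (fun y : evenPart N => body (y : Grassmann N)) (germEval_coord w l)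
    rw [this]
    simp
  rw [map_sub, AlgHom.commutes] at h
  exact sub_eq_zero.1 h

/-- The basis `θ^I` of the Grassmann algebra. -/
noncomputable abbrev gBasis (q : ℕ) : Module.Basis (Finset (Fin q)) ℂ (Grassmann q) :=
  (Pi.basisFun ℂ (Fin q)).ExteriorAlgebra

theorem extend_val_of_notMem {m : ℕ} {W : Set (Fin m → ℂ)} (g : W → ℂ) {z : Fin m → ℂ}
    (hz : z ∉ W) : Function.extend Subtype.val g 0 z = 0 :=
  Function.extend_apply' _ _ _ fun ⟨y, hy⟩ => hz (hy ▸ y.2)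

/-- The germ of `φ ∘ F` for a linear functional `φ`, extended by zero. -/
noncomputable def holoCoeff {m q : ℕ} {W : Set (Fin m → ℂ)} {a : Fin m → ℂ} (hW : W ∈ 𝓝 a)
    (φ : Grassmann q →ₗ[ℂ] ℂ) : holo q W →ₗ[ℂ] holoNear a where
  toFun F := ⟨Function.extend Subtype.val (fun z => φ (F.1 z)) 0,
    holoNear.mem_of_differentiableOn hW (F.2 φ)⟩
  map_add' F G := by
    refine Subtype.ext (funext fun z => ?_)
    by_cases hz : z ∈ W
    · simp [extend_val_apply _ hz]
    · simp [extend_val_of_notMem _ hz]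
  map_smul' c F := by
    refine Subtype.ext (funext fun z => ?_)
    by_cases hz : z ∈ W
    · simp [extend_val_apply _ hz]
    · simp [extend_val_of_notMem _ hz]

section superEval

variable {m q N : ℕ} {W : Set (Fin m → ℂ)} {a : Fin m → ℂ}

theorem holoCoeff_apply (hW : W ∈ 𝓝 a) (φ : Grassmann q →ₗ[ℂ] ℂ) (F : holo q W) {z : Fin m → ℂ}
    (hz : z ∈ W) : (holoCoeff hW φ F).1 z = φ (F.1 ⟨z, hz⟩) :=
  extend_val_apply (fun z : W => φ (F.1 z)) hz

variable {w : Fin m → evenPart N} (hW : W ∈ 𝓝 (bodyVec w)) (ξ : Fin q → oddPart N)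

/-- Substitution of `w` for the even and of `ξ` for the odd coordinates, as a linear map. -/
noncomputable def superEvalLin : holo q W →ₗ[ℂ] Grassmann N :=
  ∑ I, (LinearMap.mulRight ℂ (oddSubst ξ (gBasis q I))).comp
    (((evenPart N).val.comp (germEval w)).toLinearMap.comp (holoCoeff hW ((gBasis q).coord I)))

theorem superEvalLin_apply (F : holo q W) : superEvalLin hW ξ F =
    ∑ I, (germEval w (holoCoeff hW ((gBasis q).coord I) F) : Grassmann N) *
      oddSubst ξ (gBasis q I) := by
  simp only [superEvalLin, LinearMap.sum_apply]
  rfl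

theorem sum_coord_smul (ψ : Grassmann q →ₐ[ℂ] Grassmann N) (y : Grassmann q) :
    ∑ I, (gBasis q).coord I y • ψ (gBasis q I) = ψ y := by
  conv_rhs => rw [← (gBasis q).sum_repr y, map_sum]
  simp only [map_smul, Module.Basis.coord_apply]

/-- The substitution may be computed from any finite expansion of `F` in constant Grassmann
elements, not only the one in the basis. Multiplicativity, restriction and parity all rest on this
freedom. -/
theorem superEvalLin_eq_sum {ι : Type*} [Fintype ι] (F : holo q W) (f : ι → holoNear (bodyVec w))
    (y : ι → Grassmann q) (h : ∀ z (hz : z ∈ W), F.1 ⟨z, hz⟩ = ∑ j, (f j).1 z • y j) :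
    superEvalLin hW ξ F = ∑ j, (germEval w (f j) : Grassmann N) * oddSubst ξ (y j) := by
  have h1 : ∀ I, germEval w (holoCoeff hW ((gBasis q).coord I) F) =
      ∑ j, (gBasis q).coord I (y j) • germEval w (f j) := by
    intro I
    have h2 : germEval w (holoCoeff hW ((gBasis q).coord I) F) =
        germEval w (∑ j, (gBasis q).coord I (y j) • f j) := by
      refine germEval_congr w ?_
      filter_upwards [hW] with z hz
      rw [holoCoeff_apply hW _ F hz, h z hz, map_sum, AddSubmonoidClass.coe_finsetSum,
        Finset.sum_apply]
      refine Finset.sum_congr rfl fun j _ => ?_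
      rw [map_smul, smul_eq_mul, mul_comm]
      rfl
    rw [h2, map_sum]
    simp only [map_smul]
  rw [superEvalLin_apply]
  simp only [h1, AddSubmonoidClass.coe_finsetSum, Subalgebra.coe_smul, Finset.sum_mul]
  rw [Finset.sum_comm]
  refine Finset.sum_congr rfl fun j _ => ?_
  rw [← sum_coord_smul (oddSubst ξ) (y j), Finset.mul_sum]
  refine Finset.sum_congr rfl fun I _ => ?_
  rw [smul_mul_assoc, mul_smul_comm]

theorem superEvalLin_eq_mul (F : holo q W) (f : holoNear (bodyVec w)) (y : Grassmann q)
    (h : ∀ z (hz : z ∈ W), F.1 ⟨z, hz⟩ = f.1 z • y) :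
    superEvalLin hW ξ F = (germEval w f : Grassmann N) * oddSubst ξ y := by
  rw [superEvalLin_eq_sum hW ξ F (fun _ : Unit => f) (fun _ => y) (by simpa using h)]
  simp

theorem coe_eq_sum_holoCoeff (hW : W ∈ 𝓝 a) (F : holo q W) {z : Fin m → ℂ} (hz : z ∈ W) :
    F.1 ⟨z, hz⟩ = ∑ I, (holoCoeff hW ((gBasis q).coord I) F).1 z • gBasis q I := by
  simp only [holoCoeff_apply hW _ F hz, Module.Basis.coord_apply]
  exact ((gBasis q).sum_repr _).symm

/-- Substitution of `w` for the even and of `ξ` for the odd coordinates. -/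
noncomputable def superEval : holo q W →ₐ[ℂ] Grassmann N :=
  AlgHom.ofLinearMap (superEvalLin hW ξ)
    (by
      rw [superEvalLin_eq_mul hW ξ 1 1 1 fun z hz => (one_smul ℂ _).symm]
      simp)
    (by
      intro F G
      rw [superEvalLin_eq_sum hW ξ (F * G) (fun j : Finset (Fin q) × Finset (Fin q) =>
        holoCoeff hW ((gBasis q).coord j.1) F * holoCoeff hW ((gBasis q).coord j.2) G)
        (fun j => gBasis q j.1 * gBasis q j.2), superEvalLin_apply, superEvalLin_apply,
        Finset.sum_mul_sum, Fintype.sum_prod_type]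
      · refine Finset.sum_congr rfl fun I _ => Finset.sum_congr rfl fun J _ => ?_
        rw [map_mul, map_mul, Subalgebra.coe_mul]
        -- The coefficients substituted from `G` are even, so they move past the odd monomials
        -- coming from `F`.
        have hc := commute_of_even
          (germEval w (holoCoeff hW ((gBasis q).coord J) G)).2 (oddSubst ξ (gBasis q I))
        rw [mul_assoc, mul_assoc, ← mul_assoc _ (oddSubst ξ (gBasis q I)), hc.eq, mul_assoc]
      · intro z hz
        have h1 : (F * G).1 ⟨z, hz⟩ = F.1 ⟨z, hz⟩ * G.1 ⟨z, hz⟩ := rfl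
        rw [h1, coe_eq_sum_holoCoeff hW F hz, coe_eq_sum_holoCoeff hW G hz, Finset.sum_mul_sum,
          Fintype.sum_prod_type]
        refine Finset.sum_congr rfl fun I _ => Finset.sum_congr rfl fun J _ => ?_
        rw [smul_mul_smul_comm]
        rfl)

theorem superEval_apply (F : holo q W) : superEval hW ξ F =
    ∑ I, (germEval w (holoCoeff hW ((gBasis q).coord I) F) : Grassmann N) *
      oddSubst ξ (gBasis q I) :=
  superEvalLin_apply hW ξ F

theorem superEval_eq_mul (F : holo q W) (f : holoNear (bodyVec w)) (y : Grassmann q)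
    (h : ∀ z (hz : z ∈ W), F.1 ⟨z, hz⟩ = f.1 z • y) :
    superEval hW ξ F = (germEval w f : Grassmann N) * oddSubst ξ y :=
  superEvalLin_eq_mul hW ξ F f y h

theorem superEval_restrict {W' : Set (Fin m → ℂ)} (hW' : W' ∈ 𝓝 (bodyVec w)) (h : W' ⊆ W)
    (F : holo q W) : superEval hW' ξ ⟨restrictFun h F.1, holo_res h F.2⟩ = superEval hW ξ F := by
  rw [superEval_apply hW]
  refine superEvalLin_eq_sum hW' ξ _ _ _ fun z hz => ?_
  exact coe_eq_sum_holoCoeff hW F (h hz)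

theorem superEval_mem {i : ZMod 2} (F : holo q W) (hF : ∀ z, F.1 z ∈ gParity q i) :
    superEval hW ξ F ∈ gParity N i := by
  -- The projection `L` onto the part of parity `i` fixes the values of `F`, so `F` can be expanded
  -- in the homogeneous elements `L (θ^I)`.
  obtain ⟨L, hL, hLmem⟩ : ∃ L : Grassmann q →ₗ[ℂ] Grassmann q, (∀ y ∈ gParity q i, L y = y) ∧
      ∀ y, L y ∈ gParity q i := by
    obtain rfl | rfl : i = 0 ∨ i = 1 := (by decide : ∀ k : ZMod 2, k = 0 ∨ k = 1) i
    · refine ⟨evenProj q, fun y hy => ?_, fun y => (evenProj_mem y).1⟩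
      simpa using evenProj_add hy (Submodule.zero_mem _)
    · refine ⟨LinearMap.id - evenProj q, fun y hy => ?_, fun y => (evenProj_mem y).2⟩
      have h := evenProj_add (Submodule.zero_mem _) hy
      rw [zero_add] at h
      rw [LinearMap.sub_apply, h, sub_zero, LinearMap.id_apply]
  have h := superEvalLin_eq_sum hW ξ F (fun I => holoCoeff hW ((gBasis q).coord I) F)
    (fun I => L (gBasis q I)) (by
      intro z hz
      rw [← hL _ (hF ⟨z, hz⟩)]
      conv_lhs => rw [coe_eq_sum_holoCoeff hW F hz, map_sum]
      simp only [map_smul])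
  change superEvalLin hW ξ F ∈ _
  rw [h]
  refine Submodule.sum_mem _ fun I _ => ?_
  have := gParity_mul_mem (germEval w (holoCoeff hW ((gBasis q).coord I) F)).2
    (oddSubst_mem ξ (hLmem (gBasis q I)))
  rwa [zero_add] at this

theorem body_superEval (F : holo q W) :
    body (superEval hW ξ F) = body (F.1 ⟨bodyVec w, mem_of_mem_nhds hW⟩) := by
  have hsum : ∀ {n : ℕ} (f : Finset (Fin q) → Grassmann n),
      body (∑ I, f I) = ∑ I, body (f I) := fun f => map_sum _ _ _
  rw [superEval_apply, coe_eq_sum_holoCoeff hW F, hsum, hsum]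
  refine Finset.sum_congr rfl fun I _ => ?_
  rw [body_mul, body_germEval, body_oddSubst]
  exact (map_smul (ExteriorAlgebra.algebraMapInv (R := ℂ) (M := Fin q → ℂ)) _ _).symm

end superEval

end SuperGeometry

/-! ### Values of sections are their bodies -/

namespace SuperGeometry
open Filter Topology

theorem body_rescale {n : ℕ} (c : ℂ) (y : Grassmann n) : body (Grassmann.rescale n c y) = body y := by
  have h : (ExteriorAlgebra.algebraMapInv (R := ℂ) (M := Fin n → ℂ)).comp
      (Grassmann.rescale n c) = ExteriorAlgebra.algebraMapInv := by
    refine ExteriorAlgebra.hom_ext (LinearMap.ext fun m => ?_)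
    have h1 := body_ι m
    have h2 : body (Grassmann.rescale n c (ExteriorAlgebra.ι ℂ m)) = 0 := by
      rw [Grassmann.rescale, ExteriorAlgebra.map_apply_ι, body_ι]
    exact h2.trans h1.symm
  exact AlgHom.congr_fun h y

theorem section_apply_smul {p q : ℕ} {V : TopologicalSpace.Opens (ProjSpace p)}
    (s : projSections p q V) (t : ℂˣ) {z : Fin (p + 1) → ℂ} (hz : z ∈ cone V) :
    Grassmann.rescale q (t : ℂ)⁻¹ (s.1 ⟨t⁻¹ • z, smul_mem_cone hz t⁻¹⟩) = s.1 ⟨z, hz⟩ :=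
  congrFun (s.2.2 t) ⟨z, hz⟩

/-- Rescaling the generators leaves the degree-zero component unchanged, so the body of an invariant
section is homogeneous of degree zero. -/
theorem body_section_eq {p q : ℕ} {V : TopologicalSpace.Opens (ProjSpace p)}
    (s : projSections p q V) {z z' : Fin (p + 1) → ℂ} (hz : z ∈ cone V) (hz' : z' ∈ cone V)
    (h : Projectivization.mk ℂ z hz.1 = Projectivization.mk ℂ z' hz'.1) :
    body (s.1 ⟨z, hz⟩) = body (s.1 ⟨z', hz'⟩) := by
  obtain ⟨t, ht⟩ := (Projectivization.mk_eq_mk_iff ℂ z z' hz.1 hz'.1).1 h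
  subst ht
  have h1 := section_apply_smul s t⁻¹ hz'
  rw [← h1, body_rescale]
  simp only [inv_inv]

/-- Restriction of sections of the structure sheaf of the superprojective space. -/
noncomputable def projRes {p : ℕ} (q : ℕ) {V' V : TopologicalSpace.Opens (ProjSpace p)}
    (h : V' ≤ V) : projSections p q V →ₐ[ℂ] projSections p q V' :=
  (superProj p q).res h

/-- Evaluation of sections at a point of the cone. -/
noncomputable def evalAt {p : ℕ} (q : ℕ) (V : TopologicalSpace.Opens (ProjSpace p))
    {z : Fin (p + 1) → ℂ} (hz : z ∈ cone V) : projSections p q V →ₐ[ℂ] Grassmann q :=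
  (Pi.evalAlgHom ℂ (fun _ : cone V => Grassmann q) ⟨z, hz⟩).comp (projSections p q V).val

/-- The section given by an invariant holomorphic function. -/
noncomputable def scalarSection {p : ℕ} (q : ℕ) (V : TopologicalSpace.Opens (ProjSpace p))
    (g : (Fin (p + 1) → ℂ) → ℂ) (hg : DifferentiableOn ℂ g (cone V))
    (hinv : ∀ z ∈ cone V, ∀ t : ℂˣ, g (t • z) = g z) : projSections p q V :=
  ⟨fun z => algebraMap ℂ (Grassmann q) (g z), by
    intro φ
    refine (hg.mul_const (φ 1)).congr fun z hz => ?_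
    rw [extend_val_apply _ hz]
    beta_reduce
    rw [Algebra.algebraMap_eq_smul_one, map_smul, smul_eq_mul], by
    intro t
    funext z
    simp only [scalarAct, AlgHom.commutes]
    rw [hinv z.1 z.2]⟩

/-- On the open set where the body `f` does not vanish, `f` and `f⁻¹` are themselves invariant
sections. There `s * f⁻¹ - 1` has zero body at every point and is nilpotent by the uniform exponent,
so `s` is a unit. -/
theorem exists_isUnit_res {p q : ℕ} {V : TopologicalSpace.Opens (ProjSpace p)}
    (s : projSections p q V) {z : Fin (p + 1) → ℂ} (hz : z ∈ cone V)
    (h : body (s.1 ⟨z, hz⟩) ≠ 0) :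
    ∃ (V' : TopologicalSpace.Opens (ProjSpace p)) (hV : V' ≤ V),
      Projectivization.mk ℂ z hz.1 ∈ V' ∧ IsUnit (projRes q hV s) := by
  let f : (Fin (p + 1) → ℂ) → ℂ := Function.extend Subtype.val (fun y : cone V => body (s.1 y)) 0
  have hf : DifferentiableOn ℂ f (cone V) :=
    s.2.1 (ExteriorAlgebra.algebraMapInv (R := ℂ) (M := Fin q → ℂ)).toLinearMap
  have hfapp : ∀ y (hy : y ∈ cone V), f y = body (s.1 ⟨y, hy⟩) := fun y hy =>
    extend_val_apply (fun y : cone V => body (s.1 y)) hy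
  let V' : TopologicalSpace.Opens (ProjSpace p) :=
    { carrier := {x | ∃ (y : Fin (p + 1) → ℂ) (hy : y ∈ cone V),
        x = Projectivization.mk ℂ y hy.1 ∧ f y ≠ 0}
      is_open' := by
        have ho : IsOpen (cone V ∩ f ⁻¹' {0}ᶜ) :=
          hf.continuousOn.isOpen_inter_preimage (cone_isOpen V) isOpen_compl_singleton
        have he : (Projectivization.mk' ℂ : {v : Fin (p + 1) → ℂ // v ≠ 0} → ProjSpace p) ⁻¹'
            {x | ∃ (y : Fin (p + 1) → ℂ) (hy : y ∈ cone V),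
              x = Projectivization.mk ℂ y hy.1 ∧ f y ≠ 0} =
            Subtype.val ⁻¹' (cone V ∩ f ⁻¹' {0}ᶜ) := by
          ext v
          constructor
          · rintro ⟨y, hy, hvy, hfy⟩
            have hv : v.1 ∈ cone V := by
              refine ⟨v.2, ?_⟩
              have h1 : Projectivization.mk ℂ v.1 v.2 = Projectivization.mk ℂ y hy.1 := hvy
              rw [h1]
              exact hy.2
            refine ⟨hv, ?_⟩
            change f v.1 ≠ 0
            rw [hfapp _ hv, body_section_eq s hv hy hvy, ← hfapp]
            exact hfy
          · rintro ⟨hv, hfv⟩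
            exact ⟨v.1, hv, rfl, hfv⟩
        change IsOpen ((Projectivization.mk' ℂ : {v : Fin (p + 1) → ℂ // v ≠ 0} → ProjSpace p) ⁻¹' _)
        rw [he]
        exact ho.preimage continuous_subtype_val }
  have hV : V' ≤ V := by
    rintro x ⟨y, hy, rfl, -⟩
    exact hy.2
  have hcone : cone V' ⊆ cone V := fun y hy => ⟨hy.1, hV hy.2⟩
  have hne : ∀ y ∈ cone V', f y ≠ 0 := by
    intro y hy
    obtain ⟨h0, y', hy', he, hne⟩ := id hy
    rw [hfapp _ (hcone hy), body_section_eq s (hcone hy) hy' he, ← hfapp]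
    exact hne
  have hinv : ∀ y ∈ cone V', ∀ t : ℂˣ, f (t • y) = f y := by
    intro y hy t
    have hy1 := hcone hy
    have hy2 := smul_mem_cone hy1 t
    rw [hfapp _ hy1, hfapp _ hy2]
    exact body_section_eq s hy2 hy1 ((Projectivization.mk_eq_mk_iff ℂ _ _ _ _).2 ⟨t, rfl⟩)
  refine ⟨V', hV, ⟨z, hz, rfl, by rwa [hfapp _ hz]⟩, ?_⟩
  let F : projSections p q V' := projRes q hV s
  let u : projSections p q V' := scalarSection q V' f (hf.mono hcone) hinv
  let u' : projSections p q V' := scalarSection q V' (fun y => (f y)⁻¹)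
    ((hf.mono hcone).fun_inv hne) fun y hy t => by rw [hinv y hy]
  have huu' : u * u' = 1 := by
    refine Subtype.ext (funext fun y => ?_)
    change algebraMap ℂ (Grassmann q) (f y.1) * algebraMap ℂ (Grassmann q) (f y.1)⁻¹ = 1
    rw [← map_mul, mul_inv_cancel₀ (hne y.1 y.2), map_one]
  have hu'u : u' * u = 1 := by
    refine Subtype.ext (funext fun y => ?_)
    change algebraMap ℂ (Grassmann q) (f y.1)⁻¹ * algebraMap ℂ (Grassmann q) (f y.1) = 1
    rw [← map_mul, inv_mul_cancel₀ (hne y.1 y.2), map_one]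
  have hnil : IsNilpotent (F * u' - 1) := by
    obtain ⟨k, hk⟩ := exists_pow_eq_zero q
    refine ⟨k, Subtype.ext (funext fun y => ?_)⟩
    change (s.1 ⟨y.1, hcone y.2⟩ * algebraMap ℂ (Grassmann q) (f y.1)⁻¹ - 1) ^ k = 0
    refine hk _ ?_
    rw [body_sub, body_mul, body_algebraMap, body_one, ← hfapp,
      mul_inv_cancel₀ (hne y.1 y.2), sub_self]
  have h1 : IsUnit (F * u') := by
    have := hnil.isUnit_add_one
    rwa [sub_add_cancel] at this
  have h2 : IsUnit u := ⟨⟨u, u', huu', hu'u⟩, rfl⟩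
  have h3 := h1.mul h2
  rwa [mul_assoc, hu'u, mul_one] at h3

theorem superProj_body_eq_of_hasValue {p q : ℕ} {V : TopologicalSpace.Opens (ProjSpace p)}
    {s : (superProj p q).sec V} {z : Fin (p + 1) → ℂ} (hz : z ∈ cone V) {c : ℂ}
    (h : (superProj p q).HasValue s (Projectivization.mk ℂ z hz.1) c) :
    body (s.1 ⟨z, hz⟩) = c := by
  by_contra hne
  let s' : projSections p q V := s
  obtain ⟨V', hV, hmem, hu⟩ := exists_isUnit_res
    (s' - algebraMap ℂ (projSections p q V) c) hz (by
      change body (s.1 ⟨z, hz⟩ - algebraMap ℂ (Grassmann q) c) ≠ 0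
      rw [body_sub, body_algebraMap]
      exact sub_ne_zero.2 hne)
  exact h.2 V' hV hmem hu

theorem superProj_hasValue {p q : ℕ} {V : TopologicalSpace.Opens (ProjSpace p)}
    (s : (superProj p q).sec V) {z : Fin (p + 1) → ℂ} (hz : z ∈ cone V) :
    (superProj p q).HasValue s (Projectivization.mk ℂ z hz.1) (body (s.1 ⟨z, hz⟩)) := by
  refine ⟨hz.2, fun V' hV hmem hu => ?_⟩
  have hz' : z ∈ cone V' := ⟨hz.1, hmem⟩
  have h1 : IsUnit (s.1 ⟨z, hz⟩ - algebraMap ℂ (Grassmann q) (body (s.1 ⟨z, hz⟩))) :=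
    IsUnit.map (evalAt q V' hz') hu
  refine not_isUnit_of_body_eq_zero ?_ h1
  rw [body_sub, body_algebraMap, sub_self]

/-- Evaluation of sections of the structure sheaf of the superpoint. -/
noncomputable def superpointEval (N : ℕ) (U : TopologicalSpace.Opens (Fin 0 → ℂ)) {x : Fin 0 → ℂ}
    (hx : x ∈ U) : holo N (U : Set (Fin 0 → ℂ)) →ₐ[ℂ] Grassmann N :=
  (Pi.evalAlgHom ℂ (fun _ : (U : Set (Fin 0 → ℂ)) => Grassmann N) ⟨x, hx⟩).comp
    (holo N (U : Set (Fin 0 → ℂ))).val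

theorem superpointEval_injective (N : ℕ) (U : TopologicalSpace.Opens (Fin 0 → ℂ)) {x : Fin 0 → ℂ}
    (hx : x ∈ U) : Function.Injective (superpointEval N U hx) := by
  intro s t hst
  refine Subtype.ext (funext fun y => ?_)
  obtain rfl : y = ⟨x, hx⟩ := Subtype.ext (Subsingleton.elim (α := Fin 0 → ℂ) _ _)
  exact hst

theorem superpoint_hasValue {N : ℕ} {U : TopologicalSpace.Opens (Fin 0 → ℂ)}
    (s : (superpoint N).sec U) {x : Fin 0 → ℂ} (hx : x ∈ U) :
    (superpoint N).HasValue s x (body (s.1 ⟨x, hx⟩)) := by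
  refine ⟨hx, fun V' hV hmem hu => ?_⟩
  have h1 : IsUnit (s.1 ⟨x, hx⟩ - algebraMap ℂ (Grassmann N) (body (s.1 ⟨x, hx⟩))) :=
    IsUnit.map (superpointEval N V' hmem) hu
  refine not_isUnit_of_body_eq_zero ?_ h1
  rw [body_sub, body_algebraMap, sub_self]

theorem superpoint_isUnit_of_body_ne_zero {N : ℕ} {U : TopologicalSpace.Opens (Fin 0 → ℂ)}
    (s : holo N (U : Set (Fin 0 → ℂ))) {x : Fin 0 → ℂ} (hx : x ∈ U)
    (h : body (superpointEval N U hx s) ≠ 0) : IsUnit s := by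
  have h1 : IsUnit (algebraMap ℂ (holo N (U : Set (Fin 0 → ℂ)))
      (body (superpointEval N U hx s))) :=
    (IsUnit.mk0 _ h).map (algebraMap ℂ _)
  have h2 : IsNilpotent (s - algebraMap ℂ _ (body (superpointEval N U hx s))) := by
    obtain ⟨k, hk⟩ := exists_pow_eq_zero N
    refine ⟨k, superpointEval_injective N U hx ?_⟩
    rw [map_pow, map_zero]
    refine hk _ ?_
    rw [map_sub, AlgHom.commutes, body_sub, body_algebraMap, sub_self]
  have h3 := h2.isUnit_add_left_of_commute h1 (Algebra.commutes _ _).symm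
  rwa [add_sub_cancel] at h3

theorem superpoint_body_eq_of_hasValue {N : ℕ} {U : TopologicalSpace.Opens (Fin 0 → ℂ)}
    {s : (superpoint N).sec U} {x : Fin 0 → ℂ} (hx : x ∈ U) {c : ℂ}
    (h : (superpoint N).HasValue s x c) : body (s.1 ⟨x, hx⟩) = c := by
  by_contra hne
  let s' : holo N (U : Set (Fin 0 → ℂ)) := s
  have hu : IsUnit (s' - algebraMap ℂ _ c) := by
    refine superpoint_isUnit_of_body_ne_zero _ hx ?_
    rw [map_sub, AlgHom.commutes, body_sub, body_algebraMap]
    exact sub_ne_zero.2 hne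
  exact h.2 U le_rfl hx hu

end SuperGeometry

/-! ### The morphism with given homogeneous coordinates -/

namespace SuperGeometry
open Filter Topology

variable {N p q : ℕ}

theorem cone_mem_nhds {V : TopologicalSpace.Opens (ProjSpace p)} {z : Fin (p + 1) → ℂ}
    (hz : z ≠ 0) (h : Projectivization.mk ℂ z hz ∈ V) : cone V ∈ 𝓝 z :=
  (cone_isOpen V).mem_nhds ⟨hz, h⟩

theorem mem_holo_of_dim_zero {W : Set (Fin 0 → ℂ)} (F : W → Grassmann N) : F ∈ holo N W :=
  fun _ _ _ => (hasFDerivAt_of_subsingleton _ _).differentiableAt.differentiableWithinAt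

/-- Pull-back of sections of the superprojective space under substitution. -/
noncomputable def substPullback (w : Fin (p + 1) → evenPart N) (hw : bodyVec w ≠ 0)
    (ξ : Fin q → oddPart N) (V : TopologicalSpace.Opens (ProjSpace p))
    (U : TopologicalSpace.Opens (Fin 0 → ℂ))
    (h : ∀ x ∈ U, Projectivization.mk ℂ (bodyVec w) hw ∈ V) :
    projSections p q V →ₐ[ℂ] holo N (U : Set (Fin 0 → ℂ)) where
  -- A point `y` of `U` is what guarantees that the image point lies in `V`; when `V` misses the
  -- image point, the preimage is empty and there is nothing to evaluate.
  toFun s := ⟨fun y => superEval (cone_mem_nhds hw (h y.1 y.2)) ξ ⟨s.1, s.2.1⟩,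
    mem_holo_of_dim_zero _⟩
  map_one' := Subtype.ext (funext fun y => map_one (superEval (cone_mem_nhds hw (h y.1 y.2)) ξ))
  map_mul' s t := Subtype.ext (funext fun y =>
    map_mul (superEval (cone_mem_nhds hw (h y.1 y.2)) ξ) ⟨s.1, s.2.1⟩ ⟨t.1, t.2.1⟩)
  map_zero' := Subtype.ext (funext fun y => map_zero (superEval (cone_mem_nhds hw (h y.1 y.2)) ξ))
  map_add' s t := Subtype.ext (funext fun y =>
    map_add (superEval (cone_mem_nhds hw (h y.1 y.2)) ξ) ⟨s.1, s.2.1⟩ ⟨t.1, t.2.1⟩)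
  commutes' c := Subtype.ext (funext fun y =>
    (superEval (cone_mem_nhds hw (h y.1 y.2)) ξ).commutes c)

/-- The morphism from the superpoint with homogeneous coordinates `[w : ξ]`. -/
noncomputable def substMorphism (w : Fin (p + 1) → evenPart N) (hw : bodyVec w ≠ 0)
    (ξ : Fin q → oddPart N) : (superpoint N).Hom (superProj p q) where
  base := ContinuousMap.const _ (Projectivization.mk ℂ (bodyVec w) hw)
  pullback V := substPullback w hw ξ V (TopologicalSpace.Opens.comap
    (ContinuousMap.const _ (Projectivization.mk ℂ (bodyVec w) hw)) V) fun _ hx => hx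
  pullback_mem_parity V i s hs := fun y => superEval_mem _ ξ ⟨s.1, s.2.1⟩ hs
  pullback_res {V W} h s := Subtype.ext (funext fun y =>
    superEval_restrict (cone_mem_nhds hw (h y.2)) ξ (cone_mem_nhds hw y.2)
      (fun _ hz => ⟨hz.1, h hz.2⟩) ⟨s.1, s.2.1⟩)
  -- On both sides the value is the body, and substitution preserves it.
  pullback_hasValue V s x c hs := by
    have hz : bodyVec w ∈ cone V := ⟨hw, hs.1⟩
    have h1 := superProj_body_eq_of_hasValue hz hs
    have h2 := body_superEval (cone_mem_nhds hw hs.1) ξ ⟨s.1, s.2.1⟩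
    have h3 := superpoint_hasValue (substPullback w hw ξ V (TopologicalSpace.Opens.comap
      (ContinuousMap.const _ (Projectivization.mk ℂ (bodyVec w) hw)) V) (fun _ hx => hx) s)
      (x := x) hs.1
    exact Eq.subst (motive := fun d => (superpoint N).HasValue _ x d) (h2.trans h1) h3

theorem mem_chart_of_ne_zero {z : Fin (p + 1) → ℂ} (hz : z ≠ 0) {i : Fin (p + 1)} (hi : z i ≠ 0) :
    Projectivization.mk ℂ z hz ∈ chart i :=
  ⟨z, hz, rfl, hi⟩

/-- The germ of the reciprocal of a coordinate. -/
noncomputable def coordInv {m : ℕ} {a : Fin m → ℂ} {i : Fin m} (hi : a i ≠ 0) : holoNear a :=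
  ⟨fun z => (z i)⁻¹, by
    have h1 : ∀ᶠ z : Fin m → ℂ in 𝓝 a, z i ≠ 0 := (continuous_apply i).continuousAt.eventually_ne hi
    filter_upwards [h1] with z hz
    exact (differentiable_apply (𝕜 := ℂ) i z).fun_inv hz⟩

theorem germEval_coordInv {m : ℕ} {w : Fin m → evenPart N} {i : Fin m} (hi : IsUnit (w i))
    (hi' : bodyVec w i ≠ 0) :
    germEval w (coordInv hi') = ((hi.unit⁻¹ : (evenPart N)ˣ) : evenPart N) := by
  have h : germEval w (coordInv hi') * w i = 1 := by
    rw [← germEval_coord w i, ← map_mul, ← map_one (germEval w)]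
    refine germEval_congr w ?_
    have h1 : ∀ᶠ z : Fin m → ℂ in 𝓝 (bodyVec w), z i ≠ 0 :=
      (continuous_apply i).continuousAt.eventually_ne hi'
    filter_upwards [h1] with z hz
    exact inv_mul_cancel₀ hz
  rw [← mul_one (germEval w (coordInv hi')), ← hi.mul_val_inv, ← mul_assoc, h, one_mul]

theorem superEval_evenCoord {w : Fin (p + 1) → evenPart N} (ξ : Fin q → oddPart N)
    {i : Fin (p + 1)} (hi : IsUnit (w i)) (l : Fin (p + 1))
    (hW : cone (chart i) ∈ 𝓝 (bodyVec w)) :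
    superEval hW ξ ⟨(evenCoord q i l).1, (evenCoord q i l).2.1⟩ =
      ((hi.unit⁻¹ : (evenPart N)ˣ) : evenPart N) * (w l : Grassmann N) := by
  have hi' : bodyVec w i ≠ 0 := (evenPart_isUnit_iff _).1 hi
  rw [superEval_eq_mul hW ξ _ (coordInv hi' * holoNear.coord _ l) 1, map_one, mul_one, map_mul,
    germEval_coordInv hi, germEval_coord, Subalgebra.coe_mul]
  intro z hz
  change algebraMap ℂ (Grassmann q) (z l / z i) = ((z i)⁻¹ * z l) • 1
  rw [Algebra.algebraMap_eq_smul_one, div_eq_inv_mul]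

theorem superEval_oddCoord {w : Fin (p + 1) → evenPart N} (ξ : Fin q → oddPart N)
    {i : Fin (p + 1)} (hi : IsUnit (w i)) (r : Fin q)
    (hW : cone (chart i) ∈ 𝓝 (bodyVec w)) :
    superEval hW ξ ⟨(oddCoord i r).1, (oddCoord i r).2.1⟩ =
      ((hi.unit⁻¹ : (evenPart N)ˣ) : evenPart N) * (ξ r : Grassmann N) := by
  have hi' : bodyVec w i ≠ 0 := (evenPart_isUnit_iff _).1 hi
  rw [superEval_eq_mul hW ξ _ (coordInv hi') (Grassmann.gen r), germEval_coordInv hi, oddSubst_gen]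
  intro z hz
  rfl

end SuperGeometry

/-! ### A morphism is determined by its affine coordinates in one chart -/

namespace SuperGeometry
open Filter Topology

variable {N p q : ℕ}

theorem hom_superpoint_ext {Y : SuperRingedSpace} {τ σ : (superpoint N).Hom Y}
    (hpt : imagePoint τ = imagePoint σ)
    (h : ∀ (V : TopologicalSpace.Opens Y.carrier) (hτ : imagePoint τ ∈ V) (hσ : imagePoint σ ∈ V)
      (s : Y.sec V), pullbackAt τ hτ s = pullbackAt σ hσ s) : τ = σ := by
  obtain ⟨b, f, f1, f2, f3⟩ := τ
  obtain ⟨b', g, g1, g2, g3⟩ := σ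
  obtain rfl : b = b' := by
    refine ContinuousMap.ext fun x => ?_
    obtain rfl : x = (0 : Fin 0 → ℂ) := Subsingleton.elim (α := Fin 0 → ℂ) _ _
    exact hpt
  obtain rfl : f = g := by
    refine funext fun V => AlgHom.ext fun s => Subtype.ext (funext fun y => ?_)
    obtain ⟨y, hy⟩ := y
    obtain rfl : y = (0 : Fin 0 → ℂ) := Subsingleton.elim (α := Fin 0 → ℂ) _ _
    exact h V hy hy s
  rfl

/-- The image point of a morphism from the superpoint, as a point of the projective space. -/
noncomputable def projPoint (τ : (superpoint N).Hom (superProj p q)) : ProjSpace p :=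
  imagePoint τ

/-- The pull-back of sections to the superpoint as an algebra homomorphism. -/
noncomputable def pullbackHom (τ : (superpoint N).Hom (superProj p q))
    (V : TopologicalSpace.Opens (ProjSpace p)) (h : projPoint τ ∈ V) :
    projSections p q V →ₐ[ℂ] Grassmann N :=
  (superpointEval N (TopologicalSpace.Opens.comap τ.base V) (x := 0) h).comp (τ.pullback V)

theorem pullbackHom_projRes (τ : (superpoint N).Hom (superProj p q))
    {V' V : TopologicalSpace.Opens (ProjSpace p)} (hV : V' ≤ V) (h : projPoint τ ∈ V')
    (s : projSections p q V) :
    pullbackHom τ V' h (projRes q hV s) = pullbackHom τ V (hV h) s := by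
  have h1 := τ.pullback_res hV s
  exact congrArg (fun F : (superpoint N).sec (TopologicalSpace.Opens.comap τ.base V') =>
    F.1 ⟨(0 : Fin 0 → ℂ), h⟩) h1

/-- Compatibility with restrictions makes the pull-back depend only on the germ of a section at the
image point. -/
theorem pullbackHom_congr (τ : (superpoint N).Hom (superProj p q))
    {V V' W : TopologicalSpace.Opens (ProjSpace p)} (h : projPoint τ ∈ V)
    (h' : projPoint τ ∈ V') (hW : projPoint τ ∈ W) (hWV : W ≤ V) (hWV' : W ≤ V')
    {s : projSections p q V} {s' : projSections p q V'}
    (hs : projRes q hWV s = projRes q hWV' s') : pullbackHom τ V h s = pullbackHom τ V' h' s' := by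
  rw [← pullbackHom_projRes τ hWV hW, ← pullbackHom_projRes τ hWV' hW, hs]

/-- This is where compatibility of a morphism with values enters: it fixes the body of every
pulled-back section. -/
theorem body_pullbackHom (τ : (superpoint N).Hom (superProj p q))
    {V : TopologicalSpace.Opens (ProjSpace p)} (h : projPoint τ ∈ V) (s : projSections p q V)
    {z : Fin (p + 1) → ℂ} (hz : z ≠ 0) (hτ : projPoint τ = Projectivization.mk ℂ z hz) :
    body (pullbackHom τ V h s) = body (s.1 ⟨z, hz, hτ ▸ h⟩) := by
  have hzV : z ∈ cone V := ⟨hz, hτ ▸ h⟩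
  have h1 := superProj_hasValue s hzV
  refine superpoint_body_eq_of_hasValue (U := TopologicalSpace.Opens.comap τ.base V)
    (x := (0 : Fin 0 → ℂ)) h ?_
  refine τ.pullback_hasValue V s (0 : Fin 0 → ℂ) _ ?_
  have h2 : τ.base (0 : Fin 0 → ℂ) = Projectivization.mk ℂ z hz := hτ
  rw [h2]
  exact h1

theorem inv_apply_smul_units_smul (t : ℂˣ) (z : Fin (p + 1) → ℂ) (i : Fin (p + 1)) :
    ((t • z) i)⁻¹ • (t • z) = (z i)⁻¹ • z := by
  have h : t • z = (t : ℂ) • z := rfl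
  rw [h, Pi.smul_apply, smul_eq_mul, smul_smul, mul_inv, mul_right_comm,
    inv_mul_cancel₀ t.ne_zero, one_mul]

/-- The open set of points `[z]` such that `z / z_i` lies in the open set `O`. -/
def normOpen (i : Fin (p + 1)) (O : TopologicalSpace.Opens (Fin (p + 1) → ℂ)) :
    TopologicalSpace.Opens (ProjSpace p) where
  carrier := {x | ∃ (z : Fin (p + 1) → ℂ) (hz : z ≠ 0),
    x = Projectivization.mk ℂ z hz ∧ z i ≠ 0 ∧ (z i)⁻¹ • z ∈ O}
  is_open' := by
    have ho : IsOpen ({z : Fin (p + 1) → ℂ | z i ≠ 0} ∩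
        (fun z : Fin (p + 1) → ℂ => (z i)⁻¹ • z) ⁻¹' O) :=
      ContinuousOn.isOpen_inter_preimage
        (((continuous_apply i).continuousOn.inv₀ fun z hz => hz).smul continuousOn_id)
        (isOpen_ne_fun (continuous_apply i) continuous_const) O.2
    have he : (Projectivization.mk' ℂ : {v : Fin (p + 1) → ℂ // v ≠ 0} → ProjSpace p) ⁻¹'
        {x | ∃ (z : Fin (p + 1) → ℂ) (hz : z ≠ 0),
          x = Projectivization.mk ℂ z hz ∧ z i ≠ 0 ∧ (z i)⁻¹ • z ∈ O} =
        Subtype.val ⁻¹' ({z : Fin (p + 1) → ℂ | z i ≠ 0} ∩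
          (fun z : Fin (p + 1) → ℂ => (z i)⁻¹ • z) ⁻¹' O) := by
      ext v
      constructor
      · rintro ⟨z, hz, hvz, hi, hO⟩
        obtain ⟨t, ht⟩ := (Projectivization.mk_eq_mk_iff ℂ v.1 z v.2 hz).1 hvz
        have h1 : v.1 i ≠ 0 := by
          rw [← ht]
          exact mul_ne_zero t.ne_zero hi
        refine ⟨h1, ?_⟩
        change (v.1 i)⁻¹ • v.1 ∈ O
        rw [← ht, inv_apply_smul_units_smul]
        exact hO
      · rintro ⟨hi, hO⟩
        exact ⟨v.1, v.2, rfl, hi, hO⟩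
    change IsOpen ((Projectivization.mk' ℂ : {v : Fin (p + 1) → ℂ // v ≠ 0} → ProjSpace p) ⁻¹' _)
    rw [he]
    exact ho.preimage continuous_subtype_val

theorem of_mem_cone_normOpen {i : Fin (p + 1)} {O : TopologicalSpace.Opens (Fin (p + 1) → ℂ)}
    {z : Fin (p + 1) → ℂ} (h : z ∈ cone (normOpen i O)) : z i ≠ 0 ∧ (z i)⁻¹ • z ∈ O := by
  obtain ⟨h0, y, hy, hzy, hi, hO⟩ := h
  obtain ⟨t, rfl⟩ := (Projectivization.mk_eq_mk_iff ℂ z y h0 hy).1 hzy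
  exact ⟨mul_ne_zero t.ne_zero hi, by rwa [inv_apply_smul_units_smul]⟩

/-- The section `z ↦ f (z / z_i)`. -/
noncomputable def normSection (q : ℕ) (i : Fin (p + 1))
    (O : TopologicalSpace.Opens (Fin (p + 1) → ℂ)) (f : (Fin (p + 1) → ℂ) → ℂ)
    (hf : DifferentiableOn ℂ f O) : projSections p q (normOpen i O) :=
  scalarSection q (normOpen i O) (fun z => f ((z i)⁻¹ • z))
    (DifferentiableOn.comp (g := f) hf
      (fun z hz => (((differentiable_apply (𝕜 := ℂ) i z).fun_inv
        (of_mem_cone_normOpen hz).1).smul differentiableAt_id).differentiableWithinAt)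
      fun z hz => (of_mem_cone_normOpen hz).2)
    fun z _ t => by rw [inv_apply_smul_units_smul]

/-- A neighbourhood on which a germ is holomorphic. -/
def germDomain {m : ℕ} {a : Fin m → ℂ} (f : holoNear a) : TopologicalSpace.Opens (Fin m → ℂ) :=
  ⟨interior {z | DifferentiableAt ℂ f.1 z}, isOpen_interior⟩

theorem mem_germDomain {m : ℕ} {a : Fin m → ℂ} (f : holoNear a) : a ∈ germDomain f :=
  mem_interior_iff_mem_nhds.2 f.2

theorem differentiableOn_germDomain {m : ℕ} {a : Fin m → ℂ} (f : holoNear a) :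
    DifferentiableOn ℂ f.1 (germDomain f) := fun z hz =>
  (interior_subset hz : z ∈ {z | DifferentiableAt ℂ f.1 z}).differentiableWithinAt

section germHom

variable (τ : (superpoint N).Hom (superProj p q)) {i : Fin (p + 1)} {a : Fin (p + 1) → ℂ}
  (ha : a ≠ 0) (hai : a i = 1) (hτ : projPoint τ = Projectivization.mk ℂ a ha)

include hai hτ in
theorem imagePoint_mem_normOpen {O : TopologicalSpace.Opens (Fin (p + 1) → ℂ)} (hO : a ∈ O) :
    projPoint τ ∈ normOpen i O :=
  ⟨a, ha, hτ, by rw [hai]; exact one_ne_zero, by rwa [hai, inv_one, one_smul]⟩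

/-- The pull-back of the dehomogenised germ `f`. -/
noncomputable def germPullback (f : holoNear a) : Grassmann N :=
  pullbackHom τ _ (imagePoint_mem_normOpen τ ha hai hτ (mem_germDomain f))
    (normSection q i _ f.1 (differentiableOn_germDomain f))

/-- The open set used for `f` depends on `f`, so sums and products of germs live on different sets.
Freedom in the choice of the representing section is what makes `germHom` a homomorphism. -/
theorem germPullback_eq (f : holoNear a) {V : TopologicalSpace.Opens (ProjSpace p)}
    (hV : projPoint τ ∈ V) (s : projSections p q V)
    (hs : ∀ z (hz : z ∈ cone V), z i ≠ 0 →
      s.1 ⟨z, hz⟩ = algebraMap ℂ (Grassmann q) (f.1 ((z i)⁻¹ • z))) :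
    germPullback τ ha hai hτ f = pullbackHom τ V hV s := by
  have h1 := imagePoint_mem_normOpen τ ha hai hτ (mem_germDomain f)
  refine pullbackHom_congr τ h1 hV (W := normOpen i (germDomain f) ⊓ V) ⟨h1, hV⟩ inf_le_left
    inf_le_right (Subtype.ext (funext fun z => ?_))
  have hz1 : z.1 ∈ cone (normOpen i (germDomain f)) := ⟨z.2.1, z.2.2.1⟩
  exact (hs z.1 ⟨z.2.1, z.2.2.2⟩ (of_mem_cone_normOpen hz1).1).symm

/-- The homomorphism from germs of holomorphic functions at `a` induced by a morphism from the
superpoint. -/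
noncomputable def germHom : holoNear a →ₐ[ℂ] Grassmann N where
  toFun := germPullback τ ha hai hτ
  map_one' := by
    rw [germPullback_eq τ ha hai hτ 1 (V := ⊤) trivial 1, map_one]
    intro z hz _
    exact (map_one _).symm
  map_zero' := by
    rw [germPullback_eq τ ha hai hτ 0 (V := ⊤) trivial 0, map_zero]
    intro z hz _
    exact (map_zero _).symm
  map_mul' f g := by
    have h1 := imagePoint_mem_normOpen τ ha hai hτ (mem_germDomain f)
    have h2 := imagePoint_mem_normOpen τ ha hai hτ (mem_germDomain g)
    have h12 : projPoint τ ∈ normOpen i (germDomain f) ⊓ normOpen i (germDomain g) := ⟨h1, h2⟩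
    rw [germPullback_eq τ ha hai hτ (f * g)
      h12
      (projRes q inf_le_left (normSection q i _ f.1 (differentiableOn_germDomain f)) *
        projRes q inf_le_right (normSection q i _ g.1 (differentiableOn_germDomain g))),
      map_mul, pullbackHom_projRes, pullbackHom_projRes]
    · rfl
    · intro z hz _
      exact (map_mul (algebraMap ℂ (Grassmann q)) _ _).symm
  map_add' f g := by
    have h1 := imagePoint_mem_normOpen τ ha hai hτ (mem_germDomain f)
    have h2 := imagePoint_mem_normOpen τ ha hai hτ (mem_germDomain g)
    have h12 : projPoint τ ∈ normOpen i (germDomain f) ⊓ normOpen i (germDomain g) := ⟨h1, h2⟩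
    rw [germPullback_eq τ ha hai hτ (f + g)
      h12
      (projRes q inf_le_left (normSection q i _ f.1 (differentiableOn_germDomain f)) +
        projRes q inf_le_right (normSection q i _ g.1 (differentiableOn_germDomain g))),
      map_add, pullbackHom_projRes, pullbackHom_projRes]
    · rfl
    · intro z hz _
      exact (map_add (algebraMap ℂ (Grassmann q)) _ _).symm
  commutes' c := by
    rw [germPullback_eq τ ha hai hτ (algebraMap ℂ _ c) (V := ⊤) trivial (algebraMap ℂ _ c),
      AlgHom.commutes]
    intro z hz _
    rfl

theorem germHom_eq (f : holoNear a) {V : TopologicalSpace.Opens (ProjSpace p)}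
    (hV : projPoint τ ∈ V) (s : projSections p q V)
    (hs : ∀ z (hz : z ∈ cone V), z i ≠ 0 →
      s.1 ⟨z, hz⟩ = algebraMap ℂ (Grassmann q) (f.1 ((z i)⁻¹ • z))) :
    germHom τ ha hai hτ f = pullbackHom τ V hV s :=
  germPullback_eq τ ha hai hτ f hV s hs

end germHom

/-- The even affine coordinates as elements of the algebra of sections over `X_i`. -/
noncomputable def evenSection (q : ℕ) (i l : Fin (p + 1)) : projSections p q (chart i) :=
  evenCoord q i l

/-- The odd affine coordinates as elements of the algebra of sections over `X_i`. -/
noncomputable def oddSection (i : Fin (p + 1)) (r : Fin q) : projSections p q (chart i) :=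
  oddCoord i r

/-- The homomorphism from the Grassmann algebra to the sections over `X_i` sending the generators
to the odd affine coordinates. -/
noncomputable def oddCoordHom (q : ℕ) (i : Fin (p + 1)) :
    Grassmann q →ₐ[ℂ] projSections p q (chart i) :=
  ExteriorAlgebra.lift ℂ ⟨Fintype.linearCombination ℂ
    (oddSection (p := p) i), fun m => by
      refine Subtype.ext (funext fun z => ?_)
      have h : evalAt q (chart i) z.2 (Fintype.linearCombination ℂ
          (oddSection (p := p) i) m) ∈ gParity q 1 := by
        rw [Fintype.linearCombination_apply, map_sum]
        refine Submodule.sum_mem _ fun r _ => ?_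
        rw [map_smul]
        exact Submodule.smul_mem _ _ (Submodule.smul_mem _ _ (ι_mem_gParity _))
      exact mul_self_of_odd h⟩

theorem oddCoordHom_ι (i : Fin (p + 1)) (m : Fin q → ℂ) :
    oddCoordHom q i (ExteriorAlgebra.ι ℂ m) = Fintype.linearCombination ℂ
      (oddSection (p := p) i) m :=
  ExteriorAlgebra.lift_ι_apply _ _ _ m

theorem grassmann_algHom_ext {A : Type*} [Ring A] [Algebra ℂ A] {φ ψ : Grassmann q →ₐ[ℂ] A}
    (h : ∀ r, φ (Grassmann.gen r) = ψ (Grassmann.gen r)) : φ = ψ := by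
  refine ExteriorAlgebra.hom_ext ?_
  refine (Pi.basisFun ℂ (Fin q)).ext fun r => ?_
  rw [Pi.basisFun_apply]
  exact h r

theorem oddCoordHom_gen (i : Fin (p + 1)) (r : Fin q) :
    oddCoordHom q i (Grassmann.gen r) = oddSection i r := by
  rw [Grassmann.gen, oddCoordHom_ι, Fintype.linearCombination_apply_single, one_smul]

theorem oddCoordHom_apply (i : Fin (p + 1)) (y : Grassmann q) {z : Fin (p + 1) → ℂ}
    (hz : z ∈ cone (chart i)) :
    (oddCoordHom q i y).1 ⟨z, hz⟩ = Grassmann.rescale q (z i)⁻¹ y := by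
  have h : (evalAt q (chart i) hz).comp (oddCoordHom q i) = Grassmann.rescale q (z i)⁻¹ := by
    refine grassmann_algHom_ext fun r => ?_
    rw [AlgHom.comp_apply, oddCoordHom_gen]
    change (z i)⁻¹ • Grassmann.gen r = _
    simp [Grassmann.rescale, Grassmann.gen]
  exact AlgHom.congr_fun h y

/-- Invariance gives `s(z)` as the rescaling by `z_i⁻¹` of `s(z / z_i)`. Expanding the latter in the
`θ^I` displays `s`, over part of the chart, as a combination of monomials in the `Θ_r` with
coefficients `s_I(z / z_i)`. -/
theorem pullbackHom_eq_sum (τ : (superpoint N).Hom (superProj p q)) {i : Fin (p + 1)}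
    {a : Fin (p + 1) → ℂ} (ha : a ≠ 0) (hai : a i = 1)
    (hτ : projPoint τ = Projectivization.mk ℂ a ha) (hi : projPoint τ ∈ chart i)
    {V : TopologicalSpace.Opens (ProjSpace p)} (hV : projPoint τ ∈ V) (hW : cone V ∈ 𝓝 a)
    (s : projSections p q V) :
    pullbackHom τ V hV s = ∑ I, germHom τ ha hai hτ
      (holoCoeff hW ((gBasis q).coord I) ⟨s.1, s.2.1⟩) *
        pullbackHom τ (chart i) hi (oddCoordHom q i (gBasis q I)) := by
  let V' : TopologicalSpace.Opens (ProjSpace p) := V ⊓ chart i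
  have hV' : projPoint τ ∈ V' := ⟨hV, hi⟩
  have hcone : ∀ z ∈ cone V', z ∈ cone V ∧ z ∈ cone (chart i) := fun z hz =>
    ⟨⟨hz.1, hz.2.1⟩, ⟨hz.1, hz.2.2⟩⟩
  have hne : ∀ z ∈ cone V', z i ≠ 0 := fun z hz => apply_ne_zero_of_mem_cone_chart (hcone z hz).2
  have hnorm : ∀ z ∈ cone V', (z i)⁻¹ • z ∈ cone V := fun z hz =>
    smul_mem_cone (hcone z hz).1 (Units.mk0 (z i) (hne z hz))⁻¹
  let c : Finset (Fin q) → holoNear a := fun I =>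
    holoCoeff hW ((gBasis q).coord I) ⟨s.1, s.2.1⟩
  have hc : ∀ I, DifferentiableOn ℂ (c I).1 (cone V) := fun I => s.2.1 ((gBasis q).coord I)
  let t : Finset (Fin q) → projSections p q V' := fun I =>
    scalarSection q V' (fun z => (c I).1 ((z i)⁻¹ • z))
      (DifferentiableOn.comp (g := (c I).1) (hc I)
        (fun z hz => (((differentiable_apply (𝕜 := ℂ) i z).fun_inv (hne z hz)).smul
          differentiableAt_id).differentiableWithinAt) hnorm)
      fun z _ t => by rw [inv_apply_smul_units_smul]
  have ht : ∀ I, germHom τ ha hai hτ (c I) = pullbackHom τ V' hV' (t I) := fun I =>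
    germHom_eq τ ha hai hτ (c I) _ _ fun z hz _ => rfl
  have hs : projRes q inf_le_left s =
      ∑ I, t I * projRes q inf_le_right (oddCoordHom q i (gBasis q I)) := by
    refine Subtype.ext (funext fun z => ?_)
    -- Invariance under the scalar `t = z_i`, which varies with the point.
    have h1 := section_apply_smul s (Units.mk0 (z.1 i) (hne z.1 z.2)) (hcone z.1 z.2).1
    have h2 := coe_eq_sum_holoCoeff hW ⟨s.1, s.2.1⟩ (hnorm z.1 z.2)
    have h3 : evalAt q V' z.2 (∑ I, t I * projRes q inf_le_right (oddCoordHom q i (gBasis q I))) =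
        ∑ I, algebraMap ℂ (Grassmann q) ((c I).1 ((z.1 i)⁻¹ • z.1)) *
          Grassmann.rescale q (z.1 i)⁻¹ (gBasis q I) := by
      rw [map_sum]
      refine Finset.sum_congr rfl fun I _ => ?_
      rw [map_mul, ← oddCoordHom_apply i _ (hcone z.1 z.2).2]
      rfl
    refine (h1.symm.trans ?_).trans h3.symm
    refine (congrArg (Grassmann.rescale q (z.1 i)⁻¹) h2).trans ?_
    rw [map_sum]
    refine Finset.sum_congr rfl fun I _ => ?_
    rw [map_smul, Algebra.smul_def]
  rw [← pullbackHom_projRes τ (inf_le_left : V' ≤ V) hV', hs, map_sum]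
  refine Finset.sum_congr rfl fun I _ => ?_
  rw [map_mul, pullbackHom_projRes, ← ht]

/-- Every pull-back is assembled from `germHom` and the images of the odd coordinates. The former is
determined by the even coordinates through `holoNear.algHom_ext`, the latter is a homomorphism from
`Γ_q` fixed by its generators. -/
theorem hom_superProj_ext {τ σ : (superpoint N).Hom (superProj p q)}
    (hpt : imagePoint τ = imagePoint σ) {i : Fin (p + 1)} (hτ : imagePoint τ ∈ chart i)
    (hσ : imagePoint σ ∈ chart i)
    (heven : ∀ l, pullbackAt τ hτ (evenCoord q i l) = pullbackAt σ hσ (evenCoord q i l))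
    (hodd : ∀ r, pullbackAt τ hτ (oddCoord i r) = pullbackAt σ hσ (oddCoord i r)) : τ = σ := by
  obtain ⟨z, hz, hzτ, hzi⟩ := id hτ
  -- The representative of the image point with `a i = 1`, at which affine and homogeneous
  -- coordinates agree.
  let a : Fin (p + 1) → ℂ := (z i)⁻¹ • z
  have ha : a ≠ 0 := smul_ne_zero (inv_ne_zero hzi) hz
  have hai : a i = 1 := inv_mul_cancel₀ hzi
  have haτ : projPoint τ = Projectivization.mk ℂ a ha :=
    hzτ.trans ((Projectivization.mk_eq_mk_iff' ℂ _ _ _ _).2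
      ⟨z i, smul_inv_smul₀ hzi z⟩)
  have haσ : projPoint σ = Projectivization.mk ℂ a ha :=
    (show projPoint σ = projPoint τ from hpt.symm).trans haτ
  have hcoord : ∀ (ρ : (superpoint N).Hom (superProj p q))
      (hρ : projPoint ρ = Projectivization.mk ℂ a ha) (hi : projPoint ρ ∈ chart i) (l),
      germHom ρ ha hai hρ (holoNear.coord a l) =
        pullbackHom ρ (chart i) hi (evenSection q i l) := by
    intro ρ hρ hi l
    refine germHom_eq ρ ha hai hρ _ hi _ fun y hy _ => ?_
    change algebraMap ℂ (Grassmann q) (y l / y i) = algebraMap ℂ (Grassmann q) ((y i)⁻¹ * y l)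
    rw [div_eq_inv_mul]
  have hgerm : germHom τ ha hai haτ = germHom σ ha hai haσ := by
    refine holoNear.algHom_ext (fun l => ?_) fun l => ?_
    -- Compatibility with values gives `τ^* Ξ_l` the body `a l / a i = a l`.
    · refine isNilpotent_of_body_eq_zero ?_
      rw [hcoord τ haτ hτ, body_sub, body_algebraMap, body_pullbackHom τ hτ _ ha haτ]
      change body (algebraMap ℂ (Grassmann q) (a l / a i)) - a l = 0
      rw [body_algebraMap, hai, div_one, sub_self]
    · rw [hcoord τ haτ hτ, hcoord σ haσ hσ]
      exact heven l
  have hodd' : (pullbackHom τ (chart i) hτ).comp (oddCoordHom q i) =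
      (pullbackHom σ (chart i) hσ).comp (oddCoordHom q i) := by
    refine grassmann_algHom_ext fun r => ?_
    rw [AlgHom.comp_apply, AlgHom.comp_apply, oddCoordHom_gen]
    exact hodd r
  suffices h : ∀ (V : TopologicalSpace.Opens (ProjSpace p)) (hVτ : projPoint τ ∈ V)
      (hVσ : projPoint σ ∈ V) (s : projSections p q V),
      pullbackHom τ V hVτ s = pullbackHom σ V hVσ s from hom_superpoint_ext hpt h
  intro V hVτ hVσ s
  have hW : cone V ∈ 𝓝 a := cone_mem_nhds ha (haτ ▸ hVτ)
  rw [pullbackHom_eq_sum τ ha hai haτ hτ hVτ hW, pullbackHom_eq_sum σ ha hai haσ hσ hVσ hW, hgerm]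
  refine Finset.sum_congr rfl fun I _ => congrArg _ ?_
  exact AlgHom.congr_fun hodd' (gBasis q I)

end SuperGeometry

/-! ### The bijection -/

namespace SuperGeometry

variable {N p q : ℕ}

theorem bodyVec_ne_zero (x : homogeneousSet N p q) : bodyVec x.1.1 ≠ 0 := fun h => by
  obtain ⟨i, hi⟩ := (mem_homogeneousSet x.1).1 x.2
  exact (evenPart_isUnit_iff _).1 hi (congrFun h i)

/-- The morphism given by homogeneous coordinates. -/
noncomputable def coordMorphism (x : homogeneousSet N p q) : (superpoint N).Hom (superProj p q) :=
  substMorphism x.1.1 (bodyVec_ne_zero x) x.1.2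

theorem coordMorphism_coord (x : homogeneousSet N p q) {i : Fin (p + 1)} (hi : IsUnit (x.1.1 i)) :
    ∃ h : imagePoint (coordMorphism x) ∈ chart i,
      (∀ l : Fin (p + 1), pullbackAt (coordMorphism x) h (evenCoord q i l) =
        ((hi.unit⁻¹ : (evenPart N)ˣ) : evenPart N) * (x.1.1 l : Grassmann N)) ∧
      ∀ r : Fin q, pullbackAt (coordMorphism x) h (oddCoord i r) =
        ((hi.unit⁻¹ : (evenPart N)ˣ) : evenPart N) * (x.1.2 r : Grassmann N) :=
  have h := mem_chart_of_ne_zero (bodyVec_ne_zero x) ((evenPart_isUnit_iff _).1 hi)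
  ⟨h, fun l => superEval_evenCoord x.1.2 hi l (cone_mem_nhds _ h),
    fun r => superEval_oddCoord x.1.2 hi r (cone_mem_nhds _ h)⟩

set_option synthInstance.maxHeartbeats 200000 in
-- Substitution on the cone is not visibly invariant under Grassmann-valued units, but the affine
-- coordinates are: the unit cancels in each quotient by the `i`-th coordinate.
theorem coordMorphism_smul (u : (evenPart N)ˣ) (x : homogeneousSet N p q) :
    coordMorphism (u • x) = coordMorphism x := by
  obtain ⟨i, hi⟩ := (mem_homogeneousSet x.1).1 x.2
  have hi' : IsUnit ((u • x).1.1 i) := u.isUnit.mul hi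
  have hinv : ((hi'.unit⁻¹ : (evenPart N)ˣ) : evenPart N) * u =
      ((hi.unit⁻¹ : (evenPart N)ˣ) : evenPart N) := by
    have h1 : ((hi'.unit⁻¹ : (evenPart N)ˣ) : evenPart N) * (u * x.1.1 i) = 1 :=
      hi'.val_inv_mul
    rw [← mul_one (((hi'.unit⁻¹ : (evenPart N)ˣ) : evenPart N) * u), ← hi.mul_val_inv, ← mul_assoc,
      mul_assoc _ (u : evenPart N), h1, one_mul]
  have hinv' : (((hi'.unit⁻¹ : (evenPart N)ˣ) : evenPart N) : Grassmann N) * (u : evenPart N) =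
      ((hi.unit⁻¹ : (evenPart N)ˣ) : evenPart N) := congrArg Subtype.val hinv
  obtain ⟨h1, he1, ho1⟩ := coordMorphism_coord (u • x) hi'
  obtain ⟨h2, he2, ho2⟩ := coordMorphism_coord x hi
  refine hom_superProj_ext ?_ h1 h2 (fun l => ?_) fun r => ?_
  · have hu : body ((u : evenPart N) : Grassmann N) ≠ 0 := (evenPart_isUnit_iff _).1 u.isUnit
    refine (Projectivization.mk_eq_mk_iff' ℂ _ _ _ _).2
      ⟨body ((u : evenPart N) : Grassmann N), funext fun l => ?_⟩
    exact (body_mul _ _).symm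
  · rw [he1, he2, ← hinv', mul_assoc]
    rfl
  · rw [ho1, ho2, ← hinv', mul_assoc]
    rfl

set_option synthInstance.maxHeartbeats 200000 in
theorem exists_smul_eq_of_coordMorphism_eq {x y : homogeneousSet N p q}
    (h : coordMorphism x = coordMorphism y) : ∃ u : (evenPart N)ˣ, u • y = x := by
  obtain ⟨i, hi⟩ := (mem_homogeneousSet x.1).1 x.2
  obtain ⟨h1, he1, ho1⟩ := coordMorphism_coord x hi
  -- The image points agree and lie in `chart i`, so the body of the `i`-th coordinate of `y` is
  -- nonzero.
  have hyi : IsUnit (y.1.1 i) := by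
    refine (evenPart_isUnit_iff _).2 ?_
    rw [h] at h1
    exact apply_ne_zero_of_mem_cone_chart (z := bodyVec y.1.1) ⟨bodyVec_ne_zero y, h1⟩
  obtain ⟨h2, he2, ho2⟩ := coordMorphism_coord y hyi
  have hval : ((hi.unit : evenPart N) : Grassmann N) *
      (((hi.unit⁻¹ : (evenPart N)ˣ) : evenPart N) : Grassmann N) = 1 :=
    congrArg Subtype.val hi.unit.mul_inv
  have key : ∀ {V : TopologicalSpace.Opens (superProj p q).carrier}
      (hx : imagePoint (coordMorphism x) ∈ V) (hy : imagePoint (coordMorphism y) ∈ V)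
      (s : (superProj p q).sec V),
      pullbackAt (coordMorphism x) hx s = pullbackAt (coordMorphism y) hy s := by
    rw [h]
    exact fun _ _ _ => rfl
  -- The ratio of the `i`-th coordinates is the only possible unit; equality of affine coordinates
  -- makes it work for all the others.
  refine ⟨hi.unit * hyi.unit⁻¹, Subtype.ext (Prod.ext (funext fun l => Subtype.ext ?_)
    (funext fun r => Subtype.ext ?_))⟩
  · change (hi.unit : Grassmann N) * ((hyi.unit⁻¹ : (evenPart N)ˣ) : evenPart N) *
      (y.1.1 l : Grassmann N) = x.1.1 l
    rw [mul_assoc, ← he2 l, ← key h1 h2, he1 l, ← mul_assoc, hval, one_mul]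
  · change (hi.unit : Grassmann N) * ((hyi.unit⁻¹ : (evenPart N)ˣ) : evenPart N) *
      (y.1.2 r : Grassmann N) = x.1.2 r
    rw [mul_assoc, ← ho2 r, ← key h1 h2, ho1 r, ← mul_assoc, hval, one_mul]

/-- In a chart containing the image point, the pulled-back affine coordinates themselves serve as
homogeneous coordinates, normalised so that the `i`-th one is `1`. -/
theorem exists_coordMorphism_eq (τ : (superpoint N).Hom (superProj p q)) :
    ∃ x : homogeneousSet N p q, coordMorphism x = τ := by
  obtain ⟨z, hz, hτ⟩ : ∃ (z : Fin (p + 1) → ℂ) (hz : z ≠ 0),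
      projPoint τ = Projectivization.mk ℂ z hz :=
    ⟨_, (projPoint τ).rep_nonzero, (projPoint τ).mk_rep.symm⟩
  obtain ⟨i, hi⟩ := Function.ne_iff.1 hz
  have hmem : projPoint τ ∈ chart i := hτ ▸ mem_chart_of_ne_zero hz hi
  let w : Fin (p + 1) → evenPart N := fun l => ⟨pullbackAt τ hmem (evenCoord q i l),
    τ.pullback_mem_parity (chart i) 0 (evenCoord q i l)
      (fun y => (evenPart q).algebraMap_mem (y.1 l / y.1 i)) ⟨(0 : Fin 0 → ℂ), hmem⟩⟩
  let ξ : Fin q → oddPart N := fun r => ⟨pullbackAt τ hmem (oddCoord i r),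
    τ.pullback_mem_parity (chart i) 1 (oddCoord i r)
      (fun y => Submodule.smul_mem _ _ (ι_mem_gParity _)) ⟨(0 : Fin 0 → ℂ), hmem⟩⟩
  have hwi : w i = 1 := by
    have h1 : evenSection q i i = 1 := by
      refine Subtype.ext (funext fun y => ?_)
      change algebraMap ℂ (Grassmann q) (y.1 i / y.1 i) = 1
      rw [div_self (apply_ne_zero_of_mem_cone_chart y.2), map_one]
    have h2 : pullbackHom τ (chart i) hmem (evenSection q i i) = 1 := by rw [h1, map_one]
    exact Subtype.ext h2
  have hunit : IsUnit (w i) := hwi ▸ isUnit_one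
  have hinv : ((hunit.unit⁻¹ : (evenPart N)ˣ) : evenPart N) = 1 := by
    have h1 : hunit.unit = 1 := Units.ext hwi
    rw [h1, inv_one, Units.val_one]
  let x : homogeneousSet N p q := ⟨(w, ξ), (mem_homogeneousSet _).2 ⟨i, hunit⟩⟩
  obtain ⟨h1, he1, ho1⟩ := coordMorphism_coord x (i := i) hunit
  refine ⟨x, hom_superProj_ext ?_ h1 hmem (fun l => ?_) fun r => ?_⟩
  · refine Eq.trans ?_ hτ.symm
    -- Compatibility with values gives the coordinates the bodies `z l / z i`, which represent the
    -- image point of `τ`.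
    refine (Projectivization.mk_eq_mk_iff' ℂ _ _ _ _).2 ⟨(z i)⁻¹, funext fun l => ?_⟩
    have h2 := body_pullbackHom τ hmem (evenSection q i l) hz hτ
    have h3 : body (pullbackHom τ (chart i) hmem (evenSection q i l)) = z l / z i :=
      h2.trans (body_algebraMap _)
    exact (div_eq_inv_mul (z l) (z i)).symm.trans h3.symm
  · rw [he1 l, hinv, OneMemClass.coe_one, one_mul]
  · rw [ho1 r, hinv, OneMemClass.coe_one, one_mul]

/-- The bijection between classes of homogeneous coordinates and morphisms. -/
noncomputable def homogeneousEquiv (N p q : ℕ) :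
    HomogeneousModel N p q ≃ (superpoint N).Hom (superProj p q) :=
  Equiv.ofBijective
    (Quotient.lift coordMorphism fun x y h => by
      obtain ⟨u, rfl⟩ := MulAction.orbitRel_apply.1 h
      exact coordMorphism_smul u y)
    ⟨fun x y => Quotient.inductionOn₂ x y fun _ _ h =>
        Quotient.sound (MulAction.orbitRel_apply.2 (exists_smul_eq_of_coordMorphism_eq h)),
      fun τ => (exists_coordMorphism_eq τ).elim fun x hx => ⟨homogeneousClass x, hx⟩⟩

end SuperGeometry

theorem mainTheorem1 (N p q : ℕ) :
    ∃ Φ : SuperGeometry.HomogeneousModel N p q ≃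
        (SuperGeometry.superpoint N).Hom (SuperGeometry.superProj p q),
      ∀ x : SuperGeometry.homogeneousSet N p q,
        (∃ hb : (fun l => SuperGeometry.body (x.1.1 l : SuperGeometry.Grassmann N)) ≠ 0,
          SuperGeometry.imagePoint (Φ (SuperGeometry.homogeneousClass x)) =
            Projectivization.mk ℂ
              (fun l => SuperGeometry.body (x.1.1 l : SuperGeometry.Grassmann N)) hb) ∧
        ∀ (i : Fin (p + 1)) (hi : IsUnit (x.1.1 i)),
          ∃ h : SuperGeometry.imagePoint (Φ (SuperGeometry.homogeneousClass x)) ∈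
              SuperGeometry.chart i,
            (∀ l : Fin (p + 1),
              SuperGeometry.pullbackAt (Φ (SuperGeometry.homogeneousClass x)) h
                  (SuperGeometry.evenCoord q i l) =
                ((hi.unit⁻¹ : (SuperGeometry.evenPart N)ˣ) : SuperGeometry.evenPart N) *
                  (x.1.1 l : SuperGeometry.Grassmann N)) ∧
            ∀ r : Fin q,
              SuperGeometry.pullbackAt (Φ (SuperGeometry.homogeneousClass x)) h
                  (SuperGeometry.oddCoord i r) =
                ((hi.unit⁻¹ : (SuperGeometry.evenPart N)ˣ) : SuperGeometry.evenPart N) *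
                  (x.1.2 r : SuperGeometry.Grassmann N) := by
  exact ⟨SuperGeometry.homogeneousEquiv N p q, fun x =>
    ⟨⟨SuperGeometry.bodyVec_ne_zero x, rfl⟩, fun _ hi => SuperGeometry.coordMorphism_coord x hi⟩⟩
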